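/- Let $\mathbf{Pord}$ be the category of (small) preorders and monotone maps, enriched in itself by the pointwise preorder on hom-sets. For a preorder $A$ let $P(A)$ be the poset of down-closed subsets of $A$, ordered by inclusion. For a monotone map $f\colon A\to B$ put $$Kf=\{(\phi,b)\in P(A)\times B:\ f(a)\le b\text{ for all }a\in\phi\},\qquad \lambda_f(a)=(\{a'\in A: a'\le a\},f(a)),\qquad \rho_f(\phi,b)=b,$$ with the order of $P(A)\times B$. A square $(h,k)\colon f\to g$ acts by $(\phi,b)\mapsto({\downarrow}h(\phi),k(b))$, and, with comultiplication $(\phi,b)\mapsto(\phi,(\phi,b))$ and multiplication $(\Psi,b)\mapsto(\bigcup\{\phi:(\phi,b')\in\Psi\},b)$, this is a $\mathbf{Pord}$-enriched algebraic weak factorisation system (AWFS) $(\mathsf L,\mathsf R)$ on $\mathbf{Pord}$. *Terminology.* Let $(\mathsf E,\mathsf M)$ be a $\mathbf{Pord}$-enriched AWFS on $\mathbf{Pord}$; it is *cocontinuous* if its functor $K\colon\mathbf{Pord}^{\mathbf 2}\to\mathbf{Pord}$ preserves small colimits. Let $\mathbb J$ be a small internal category in $\mathbf{Pord}$-categories,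 with category of arrows $\mathcal J$, and let $U$ be an internal functor from $\mathbb J$ to the internal category of squares $\mathbf{Pord}^{\mathbf 2}\rightrightarrows\mathbf{Pord}$. Let $\mathbb J^{\pitchfork\!\!\pitchfork_{\mathsf M}}$ be the internal category over the squares of $\mathbf{Pord}$ whose objects of arrows are morphisms $g\colon X\to Y$ equipped with an $\mathsf M$-algebra structure on each map $\mathbf{Pord}(\operatorname{cod}Uj,X)\to\mathbf{Pord}^{\mathbf 2}(Uj,g)$, $d\mapsto(d\cdot Uj,g\cdot d)$, natural in $j\in\mathcal J$ and compatible with the vertical composition of $\mathbb J$. An AWFS $(\mathsf L,\mathsf R)$ is *cofibrantly generated with respect to* $(\mathsf E,\mathsf M)$ if for some such $\mathbb J$ the internal category of $\mathsf R$-algebras is isomorphic to $\mathbb J^{\pitchfork\!\!\pitchfork_{\mathsf M}}$ over the internal category of squares. It is *cofibrantly KZ-generated* if this holds for the AWFS whose $\mathsf M$-algebras are the monotone maps equipped with a left adjoint whose unit is an identity. **Theorem.** The AWFS $(\mathsf L,\mathsf R)$ is lax orthogonal; a monotone map $f$ carries an $\mathsf L$-coalgebra structure if and only if it belongs to the left class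 of the underlying weak factorisation system (WFS), and if and only if it is full ($f(a)\le f(a')$ implies $a\le a'$); a preorder $X$ carries an $\mathsf R$-algebra structure on $X\to1$ if and only if $X\to 1$ belongs to the right class of the underlying WFS, and if and only if $X$ is a complete lattice; and the morphisms of such algebras over $1$ are the maps preserving all suprema. Moreover: 1. $(\mathsf L,\mathsf R)$ is not cofibrantly KZ-generated; 2. $(\mathsf L,\mathsf R)$ is not cofibrantly generated with respect to any cocontinuous $\mathbf{Pord}$-enriched AWFS on $\mathbf{Pord}$; 3. the underlying WFS of $(\mathsf L,\mathsf R)$ is not cofibrantly generated: there is no small set of morphisms $I$ such that its right class consists of the morphisms with the right lifting property against $I$; 4. every regular cardinal $\beta$, regarded as an ordinal, is the $\beta$-filtered colimit (union) in $\mathbf{Pord}$ of the complete lattices $\operatorname{succ}(\mu)=\{\nu:\nu\le\mu\}$, $\mu<\beta$, along the inclusions, which preserve all suprema, but $\beta$ is not itself a complete lattice. -/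

import Mathlib

open CategoryTheory Limits

universe u v w

noncomputable section

/-! ### Categories enriched in preorders -/

/-- A category enriched in the cartesian closed category of preorders: a category whose hom-sets
are preordered in such a way that composition is monotone. -/
class PordCategory (C : Type w) [Category.{v} C] where
  [homPreorder : ∀ X Y : C, Preorder (X ⟶ Y)]
  comp_mono : ∀ {X Y Z : C} {f f' : X ⟶ Y} {g g' : Y ⟶ Z}, f ≤ f' → g ≤ g' → f ≫ g ≤ f' ≫ g'

attribute [instance, reducible] PordCategory.homPreorder

/-- The category of preorders is enriched in itself by the pointwise preorder on monotone maps. -/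
instance Preord.instPordCategory : PordCategory Preord.{u} where
  homPreorder X Y := Preorder.lift fun f : X ⟶ Y => (f : X → Y)
  comp_mono := by
    intro X Y Z f f' g g' hf hg x
    exact le_trans (g.hom.monotone (hf x)) (hg (f' x))

/-- Commutative squares from `f` to `g`, i.e. morphisms `f ⟶ g` in the arrow category `C²`. -/
@[ext]
structure Square {C : Type w} [Category.{v} C] {A B X Y : C} (f : A ⟶ B) (g : X ⟶ Y) where
  left : A ⟶ X
  right : B ⟶ Y
  comm : f ≫ right = left ≫ g

namespace Square

variable {C : Type w} [Category.{v} C]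

/-- The identity square. -/
@[simps]
def id {A B : C} (f : A ⟶ B) : Square f f := ⟨𝟙 A, 𝟙 B, by simp⟩

/-- Horizontal composition of squares. -/
@[simps]
def comp {A B X Y Z W : C} {f : A ⟶ B} {g : X ⟶ Y} {h : Z ⟶ W} (s : Square f g)
    (t : Square g h) : Square f h :=
  ⟨s.left ≫ t.left, s.right ≫ t.right, by
    rw [← Category.assoc, s.comm, Category.assoc, t.comm, Category.assoc]⟩

/-- The hom-preorders of `C²` are componentwise. -/
instance [PordCategory C] {A B X Y : C} (f : A ⟶ B) (g : X ⟶ Y) : Preorder (Square f g) :=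
  Preorder.lift fun s : Square f g => (s.left, s.right)

end Square

/-! ### Algebraic weak factorisation systems -/

/-- A preorder-enriched functorial factorisation `A --lam f--> K f --rho f--> B` of the
morphisms `f : A ⟶ B` of a preorder-enriched category. -/
structure FunFact (C : Type w) [Category.{v} C] [PordCategory C] where
  K : ∀ {A B : C}, (A ⟶ B) → C
  lam : ∀ {A B : C} (f : A ⟶ B), A ⟶ K f
  rho : ∀ {A B : C} (f : A ⟶ B), K f ⟶ B
  fac : ∀ {A B : C} (f : A ⟶ B), lam f ≫ rho f = f
  map : ∀ {A B X Y : C} {f : A ⟶ B} {g : X ⟶ Y}, Square f g → (K f ⟶ K g)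
  map_id : ∀ {A B : C} (f : A ⟶ B), map (Square.id f) = 𝟙 (K f)
  map_comp : ∀ {A B X Y Z W : C} {f : A ⟶ B} {g : X ⟶ Y} {h : Z ⟶ W}
    (s : Square f g) (t : Square g h), map (s.comp t) = map s ≫ map t
  map_mono : ∀ {A B X Y : C} {f : A ⟶ B} {g : X ⟶ Y} {s t : Square f g}, s ≤ t → map s ≤ map t
  lam_map : ∀ {A B X Y : C} {f : A ⟶ B} {g : X ⟶ Y} (s : Square f g),
    lam f ≫ map s = s.left ≫ lam g
  rho_map : ∀ {A B X Y : C} {f : A ⟶ B} {g : X ⟶ Y} (s : Square f g),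
    rho f ≫ s.right = map s ≫ rho g

namespace FunFact

variable {C : Type w} [Category.{v} C] [PordCategory C] (F : FunFact C)

/-- The factorisation as a functor `K : C² ⥤ C`. -/
def functor : Arrow C ⥤ C where
  obj f := F.K f.hom
  map {f g} s := F.map (f := f.hom) (g := g.hom) ⟨s.left, s.right, (Arrow.w s).symm⟩
  map_id f := F.map_id f.hom
  map_comp {f g h} s t := F.map_comp (f := f.hom) (g := g.hom) (h := h.hom)
    ⟨s.left, s.right, (Arrow.w s).symm⟩ ⟨t.left, t.right, (Arrow.w t).symm⟩

/-- The action on morphisms of the endofunctor `L : C² ⥤ C²`, `f ↦ lam f`. -/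
def mapL {A B X Y : C} {f : A ⟶ B} {g : X ⟶ Y} (s : Square f g) : Square (F.lam f) (F.lam g) :=
  ⟨s.left, F.map s, F.lam_map s⟩

/-- The action on morphisms of the endofunctor `R : C² ⥤ C²`, `f ↦ rho f`. -/
def mapR {A B X Y : C} {f : A ⟶ B} {g : X ⟶ Y} (s : Square f g) : Square (F.rho f) (F.rho g) :=
  ⟨F.map s, s.right, F.rho_map s⟩

/-- The copoint `Φ : L ⟶ 1`. -/
def copoint {A B : C} (f : A ⟶ B) : Square (F.lam f) f := ⟨𝟙 A, F.rho f, by simp [F.fac]⟩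

/-- The point `Λ : 1 ⟶ R`. -/
def point {A B : C} (f : A ⟶ B) : Square f (F.rho f) := ⟨F.lam f, 𝟙 B, by simp [F.fac]⟩

end FunFact

/-- A preorder-enriched algebraic weak factorisation system: a functorial factorisation with a
comultiplication `Σ_f = (1, sig f) : lam f ⟶ lam (lam f)` making `L` a comonad, and a
multiplication `Π_f = (pi f, 1) : rho (rho f) ⟶ rho f` making `R` a monad, such that the squares
`(sig f, pi f) : lam (rho f) ⟶ rho (lam f)` form a mixed distributive law. All axioms of the
distributive law other than `distrib` follow from the (co)monad axioms. -/
structure AWFS (C : Type w) [Category.{v} C] [PordCategory C] extends FunFact C where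
  sig : ∀ {A B : C} (f : A ⟶ B), K f ⟶ K (lam f)
  pi : ∀ {A B : C} (f : A ⟶ B), K (rho f) ⟶ K f
  lam_sig : ∀ {A B : C} (f : A ⟶ B), lam f ≫ sig f = 𝟙 A ≫ lam (lam f)
  rho_pi : ∀ {A B : C} (f : A ⟶ B), rho (rho f) ≫ 𝟙 B = pi f ≫ rho f
  sig_nat : ∀ {A B X Y : C} {f : A ⟶ B} {g : X ⟶ Y} (s : Square f g),
    map s ≫ sig g = sig f ≫ map (toFunFact.mapL s)
  pi_nat : ∀ {A B X Y : C} {f : A ⟶ B} {g : X ⟶ Y} (s : Square f g),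
    map (toFunFact.mapR s) ≫ pi g = pi f ≫ map s
  sig_rho : ∀ {A B : C} (f : A ⟶ B), sig f ≫ rho (lam f) = 𝟙 (K f)
  sig_copoint : ∀ {A B : C} (f : A ⟶ B), sig f ≫ map (toFunFact.copoint f) = 𝟙 (K f)
  sig_coassoc : ∀ {A B : C} (f : A ⟶ B), sig f ≫ sig (lam f) =
    sig f ≫ map (f := lam f) (g := lam (lam f)) ⟨𝟙 A, sig f, lam_sig f⟩
  lam_pi : ∀ {A B : C} (f : A ⟶ B), lam (rho f) ≫ pi f = 𝟙 (K f)
  point_pi : ∀ {A B : C} (f : A ⟶ B), map (toFunFact.point f) ≫ pi f = 𝟙 (K f)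
  pi_assoc : ∀ {A B : C} (f : A ⟶ B), pi (rho f) ≫ pi f =
    map (f := rho (rho f)) (g := rho f) ⟨pi f, 𝟙 B, rho_pi f⟩ ≫ pi f
  distrib : ∀ {A B : C} (f : A ⟶ B), pi f ≫ sig f =
    sig (rho f) ≫ map (f := lam (rho f)) (g := rho (lam f))
      ⟨sig f, pi f, by rw [lam_pi f, sig_rho f]⟩ ≫ pi (lam f)

namespace AWFS

variable {C : Type w} [Category.{v} C] [PordCategory C] (W : AWFS C)

/-- The AWFS is lax orthogonal: the 2-monad `R` and the 2-comonad `L` are lax idempotent. In the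
preorder-enriched setting lax idempotency of a monad `(T, i, m)` is the inequality `T i ≤ i T`
(the equations on the modification `T i ⟶ i T` hold automatically), and dually `G ε ≤ ε G` for a
comonad `(G, ε, δ)`. -/
def IsLaxOrthogonal : Prop :=
  (∀ {A B : C} (f : A ⟶ B), W.mapR (W.point f) ≤ W.point (W.rho f)) ∧
  (∀ {A B : C} (f : A ⟶ B), W.mapL (W.copoint f) ≤ W.copoint (W.lam f))

/-- An `L`-coalgebra structure `(1, s) : f ⟶ lam f` on `f`. -/
@[ext]
structure Coalg {A B : C} (f : A ⟶ B) where
  str : B ⟶ W.K f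
  comm : f ≫ str = 𝟙 A ≫ W.lam f
  counit : str ≫ W.rho f = 𝟙 B
  coassoc : str ≫ W.sig f = str ≫ W.map (f := f) (g := W.lam f) ⟨𝟙 A, str, comm⟩

/-- An `R`-algebra structure `(p, 1) : rho f ⟶ f` on `f`. -/
@[ext]
structure Alg {A B : C} (f : A ⟶ B) where
  str : W.K f ⟶ A
  comm : W.rho f ≫ 𝟙 B = str ≫ f
  unit : W.lam f ≫ str = 𝟙 A
  assoc : W.map (f := W.rho f) (g := f) ⟨str, 𝟙 B, comm⟩ ≫ str = W.pi f ≫ str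

variable {W}

/-- The square `s : f ⟶ g` is a morphism of `R`-algebras. -/
def IsAlgHom {A B X Y : C} {f : A ⟶ B} {g : X ⟶ Y} (p : W.Alg f) (q : W.Alg g)
    (s : Square f g) : Prop :=
  p.str ≫ s.left = W.map s ≫ q.str

variable (W)

/-- The left class of the underlying WFS: morphisms admitting a coalgebra structure for the
copointed endofunctor `(L, Φ)`. -/
def leftClass : MorphismProperty C := fun A B f =>
  ∃ s : B ⟶ W.K f, f ≫ s = W.lam f ∧ s ≫ W.rho f = 𝟙 B

/-- The right class of the underlying WFS: morphisms admitting an algebra structure for the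
pointed endofunctor `(R, Λ)`. -/
def rightClass : MorphismProperty C := fun A B f =>
  ∃ p : W.K f ⟶ A, W.lam f ≫ p = 𝟙 A ∧ p ≫ f = W.rho f

variable {W}

/-- The square `(1, t) : lam (f ≫ g) ⟶ f`, where `t` is the lift of the cofree coalgebra
`lam (f ≫ g)` against the algebra `g`. -/
def Alg.compSquare {A B Y : C} {f : A ⟶ B} {g : B ⟶ Y} (q : W.Alg g) :
    Square (W.lam (f ≫ g)) f where
  left := 𝟙 A
  right := W.map (f := f ≫ g) (g := g) ⟨f, 𝟙 Y, by simp⟩ ≫ q.str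
  comm := by
    rw [← Category.assoc, W.lam_map]
    simp [q.unit]

theorem map_map {A B X Y Z T : C} {f : A ⟶ B} {g : X ⟶ Y} {h : Z ⟶ T}
    (s : Square f g) (t : Square g h) : W.map s ≫ W.map t = W.map (s.comp t) :=
  (W.map_comp s t).symm

theorem map_map_assoc {A B X Y Z T V : C} {f : A ⟶ B} {g : X ⟶ Y} {h : Z ⟶ T}
    (s : Square f g) (t : Square g h) (z : W.K h ⟶ V) :
    W.map s ≫ W.map t ≫ z = W.map (s.comp t) ≫ z := by
  rw [← Category.assoc, map_map]

theorem map_sig_assoc {A B X Y V : C} {f : A ⟶ B} {g : X ⟶ Y} (s : Square f g)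
    (z : W.K (W.lam g) ⟶ V) :
    W.map s ≫ W.sig g ≫ z = W.sig f ≫ W.map (W.mapL s) ≫ z := by
  rw [← Category.assoc, W.sig_nat, Category.assoc]

theorem Alg.pi_map_str {A B X Y : C} {f : A ⟶ B} {g : X ⟶ Y} (q : W.Alg g) (s : Square f g) :
    W.pi f ≫ W.map s ≫ q.str =
      W.map ((W.mapR s).comp (⟨q.str, 𝟙 Y, q.comm⟩ : Square (W.rho g) g)) ≫ q.str := by
  rw [← Category.assoc, ← W.pi_nat, Category.assoc, ← q.assoc, map_map_assoc]

theorem Alg.compStr_comp {A B Y : C} {f : A ⟶ B} {g : B ⟶ Y} (p : W.Alg f) (q : W.Alg g) :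
    (W.sig (f ≫ g) ≫ W.map q.compSquare ≫ p.str) ≫ f = (Alg.compSquare (f := f) q).right := by
  have h1 : p.str ≫ f = W.rho f := by rw [← p.comm, Category.comp_id]
  simp only [Category.assoc]
  rw [h1, ← W.rho_map, ← Category.assoc, W.sig_rho, Category.id_comp]

/-- The vertical composition of `R`-algebras: the canonical `R`-algebra structure on `f ≫ g`
determined by `R`-algebra structures on `f` and `g`. Its structure map is obtained by lifting the
cofree coalgebra `lam (f ≫ g)` first against `g` and then against `f`. -/
def Alg.comp {A B Y : C} {f : A ⟶ B} {g : B ⟶ Y} (p : W.Alg f) (q : W.Alg g) :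
    W.Alg (f ≫ g) where
  str := W.sig (f ≫ g) ≫ W.map q.compSquare ≫ p.str
  comm := by
    have h2 : q.str ≫ g = W.rho g := by rw [← q.comm, Category.comp_id]
    rw [← Category.assoc _ f g, Alg.compStr_comp p q]
    simp only [Alg.compSquare, Category.assoc]
    rw [h2, ← W.rho_map]
  unit := by
    rw [← Category.assoc, W.lam_sig, Category.id_comp, ← Category.assoc, W.lam_map]
    simp [Alg.compSquare, p.unit]
  assoc := by
    have hc := Alg.compStr_comp p q
    set c := W.sig (f ≫ g) ≫ W.map q.compSquare ≫ p.str with hcdef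
    have hcomm : W.rho (f ≫ g) ≫ 𝟙 Y = c ≫ f ≫ g := by
      have h2 : q.str ≫ g = W.rho g := by rw [← q.comm, Category.comp_id]
      rw [← Category.assoc, hc]
      simp only [Alg.compSquare, Category.assoc]
      rw [h2, ← W.rho_map]
    -- the two sides lie over the same map into the middle object
    have ht : W.map (f := W.rho (f ≫ g)) (g := f ≫ g) ⟨c, 𝟙 Y, hcomm⟩ ≫
        (Alg.compSquare (f := f) q).right = W.pi (f ≫ g) ≫ (Alg.compSquare (f := f) q).right := by
      have e1 : (Alg.compSquare (f := f) q).right =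
          W.map (f := f ≫ g) (g := g) ⟨f, 𝟙 Y, by simp⟩ ≫ q.str := rfl
      rw [e1, Alg.pi_map_str, map_map_assoc]
      congr 2
      ext
      · simp only [Square.comp_left]
        rw [hc, e1]
        rfl
      · simp [FunFact.mapR]
    calc W.map (f := W.rho (f ≫ g)) (g := f ≫ g) ⟨c, 𝟙 Y, hcomm⟩ ≫ c
        = W.sig (W.rho (f ≫ g)) ≫ W.map ((W.mapL (f := W.rho (f ≫ g)) (g := f ≫ g)
            ⟨c, 𝟙 Y, hcomm⟩).comp q.compSquare) ≫ p.str := by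
          exact (map_sig_assoc _ _).trans (by rw [map_map_assoc])
      _ = W.pi (f ≫ g) ≫ c := by
          conv_rhs => rw [hcdef]
          rw [← Category.assoc (W.pi (f ≫ g)), W.distrib]
          simp only [Category.assoc]
          rw [Alg.pi_map_str, map_map_assoc]
          congr 3
          ext
          · simp [FunFact.mapR, FunFact.mapL, Alg.compSquare, hcdef]
          · simp only [Square.comp_right, FunFact.mapL, FunFact.mapR]
            rw [ht, Category.comp_id]

/-- `R`-algebra structures lift uniquely along pullback squares: the unique algebra structure on
the pullback `f` of an algebra `g` for which the pullback square is a morphism of algebras. -/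
def Alg.pullback {A B X Y : C} {f : A ⟶ B} {g : X ⟶ Y} (q : W.Alg g) {h : A ⟶ X} {k : B ⟶ Y}
    (sq : IsPullback h f g k) : W.Alg f where
  str := sq.lift (W.map (f := f) (g := g) ⟨h, k, sq.w.symm⟩ ≫ q.str) (W.rho f) (by
    rw [Category.assoc, ← q.comm, Category.comp_id, ← W.rho_map])
  comm := by simp
  unit := by
    apply sq.hom_ext
    · rw [Category.assoc, sq.lift_fst, ← Category.assoc, W.lam_map, Category.assoc, q.unit]
      simp
    · rw [Category.assoc, sq.lift_snd, W.fac]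
      simp
  assoc := by
    apply sq.hom_ext
    · simp only [Category.assoc, sq.lift_fst]
      rw [Alg.pi_map_str, map_map_assoc]
      congr 2
      ext
      · simp [FunFact.mapR]
      · simp [FunFact.mapR]
    · simp only [Category.assoc, sq.lift_snd]
      rw [← W.rho_map, ← W.rho_pi]

theorem Alg.pullback_isAlgHom {A B X Y : C} {f : A ⟶ B} {g : X ⟶ Y} (q : W.Alg g) {h : A ⟶ X}
    {k : B ⟶ Y} (sq : IsPullback h f g k) :
    IsAlgHom (q.pullback sq) q ⟨h, k, sq.w.symm⟩ :=
  sq.lift_fst _ _ _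

end AWFS

/-! ### Small internal categories over the squares of a category -/

/-- A small internal category in the category of preorder-enriched categories (a small
preorder-enriched double category). The object of objects is the preorder-enriched category `Obj`.
The object of arrows has as objects the vertical morphisms `i : Vert a b`; a morphism `i ⟶ j` in
it is a triple of `h : a ⟶ a'`, `k : b ⟶ b'` and a cell `σ : Cell i j h k`, and `cellLE` is the
preorder on these morphisms. -/
structure PordDouble where
  Obj : Type u
  [cat : SmallCategory Obj]
  [pord : PordCategory Obj]
  Vert : Obj → Obj → Type u
  Cell : ∀ {a b a' b' : Obj}, Vert a b → Vert a' b' → (a ⟶ a') → (b ⟶ b') → Type u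
  /-- Identities and composition of the category of arrows. -/
  hId : ∀ {a b : Obj} (i : Vert a b), Cell i i (𝟙 a) (𝟙 b)
  hComp : ∀ {a b a' b' a'' b'' : Obj} {i : Vert a b} {j : Vert a' b'} {l : Vert a'' b''}
    {h : a ⟶ a'} {k : b ⟶ b'} {h' : a' ⟶ a''} {k' : b' ⟶ b''},
    Cell i j h k → Cell j l h' k' → Cell i l (h ≫ h') (k ≫ k')
  hId_comp : ∀ {a b a' b' : Obj} {i : Vert a b} {j : Vert a' b'} {h : a ⟶ a'} {k : b ⟶ b'}
    (σ : Cell i j h k), HEq (hComp (hId i) σ) σ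
  hComp_id : ∀ {a b a' b' : Obj} {i : Vert a b} {j : Vert a' b'} {h : a ⟶ a'} {k : b ⟶ b'}
    (σ : Cell i j h k), HEq (hComp σ (hId j)) σ
  hComp_assoc : ∀ {a₁ b₁ a₂ b₂ a₃ b₃ a₄ b₄ : Obj} {i₁ : Vert a₁ b₁} {i₂ : Vert a₂ b₂}
    {i₃ : Vert a₃ b₃} {i₄ : Vert a₄ b₄} {h₁ : a₁ ⟶ a₂} {k₁ : b₁ ⟶ b₂} {h₂ : a₂ ⟶ a₃}
    {k₂ : b₂ ⟶ b₃} {h₃ : a₃ ⟶ a₄} {k₃ : b₃ ⟶ b₄} (σ₁ : Cell i₁ i₂ h₁ k₁)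
    (σ₂ : Cell i₂ i₃ h₂ k₂) (σ₃ : Cell i₃ i₄ h₃ k₃),
    HEq (hComp (hComp σ₁ σ₂) σ₃) (hComp σ₁ (hComp σ₂ σ₃))
  /-- The preorder enrichment of the category of arrows. -/
  cellLE : ∀ {a b a' b' : Obj} {i : Vert a b} {j : Vert a' b'} {h h₁ : a ⟶ a'} {k k₁ : b ⟶ b'},
    Cell i j h k → Cell i j h₁ k₁ → Prop
  cellLE_refl : ∀ {a b a' b' : Obj} {i : Vert a b} {j : Vert a' b'} {h : a ⟶ a'} {k : b ⟶ b'}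
    (σ : Cell i j h k), cellLE σ σ
  cellLE_trans : ∀ {a b a' b' : Obj} {i : Vert a b} {j : Vert a' b'} {h h₁ h₂ : a ⟶ a'}
    {k k₁ k₂ : b ⟶ b'} {σ : Cell i j h k} {σ₁ : Cell i j h₁ k₁} {σ₂ : Cell i j h₂ k₂},
    cellLE σ σ₁ → cellLE σ₁ σ₂ → cellLE σ σ₂
  hComp_mono : ∀ {a b a' b' a'' b'' : Obj} {i : Vert a b} {j : Vert a' b'} {l : Vert a'' b''}
    {h h₁ : a ⟶ a'} {k k₁ : b ⟶ b'} {h' h₁' : a' ⟶ a''} {k' k₁' : b' ⟶ b''}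
    {σ : Cell i j h k} {σ₁ : Cell i j h₁ k₁} {τ : Cell j l h' k'} {τ₁ : Cell j l h₁' k₁'},
    cellLE σ σ₁ → cellLE τ τ₁ → cellLE (hComp σ τ) (hComp σ₁ τ₁)
  /-- Source and target are enriched functors. -/
  src_mono : ∀ {a b a' b' : Obj} {i : Vert a b} {j : Vert a' b'} {h h₁ : a ⟶ a'} {k k₁ : b ⟶ b'}
    {σ : Cell i j h k} {σ₁ : Cell i j h₁ k₁}, cellLE σ σ₁ → h ≤ h₁
  tgt_mono : ∀ {a b a' b' : Obj} {i : Vert a b} {j : Vert a' b'} {h h₁ : a ⟶ a'} {k k₁ : b ⟶ b'}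
    {σ : Cell i j h k} {σ₁ : Cell i j h₁ k₁}, cellLE σ σ₁ → k ≤ k₁
  /-- The enriched functor of vertical identities. -/
  vId : ∀ a : Obj, Vert a a
  vIdCell : ∀ {a a' : Obj} (h : a ⟶ a'), Cell (vId a) (vId a') h h
  vIdCell_id : ∀ a : Obj, vIdCell (𝟙 a) = hId (vId a)
  vIdCell_comp : ∀ {a a' a'' : Obj} (h : a ⟶ a') (h' : a' ⟶ a''),
    vIdCell (h ≫ h') = hComp (vIdCell h) (vIdCell h')
  vIdCell_mono : ∀ {a a' : Obj} {h h' : a ⟶ a'}, h ≤ h' → cellLE (vIdCell h) (vIdCell h')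
  /-- The enriched functor of vertical composition. -/
  vComp : ∀ {a b c : Obj}, Vert a b → Vert b c → Vert a c
  vCompCell : ∀ {a b c a' b' c' : Obj} {i : Vert a b} {j : Vert b c} {i' : Vert a' b'}
    {j' : Vert b' c'} {h : a ⟶ a'} {k : b ⟶ b'} {l : c ⟶ c'},
    Cell i i' h k → Cell j j' k l → Cell (vComp i j) (vComp i' j') h l
  vCompCell_id : ∀ {a b c : Obj} (i : Vert a b) (j : Vert b c),
    vCompCell (hId i) (hId j) = hId (vComp i j)
  vCompCell_comp : ∀ {a b c a' b' c' a'' b'' c'' : Obj} {i : Vert a b} {j : Vert b c}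
    {i' : Vert a' b'} {j' : Vert b' c'} {i'' : Vert a'' b''} {j'' : Vert b'' c''}
    {h : a ⟶ a'} {k : b ⟶ b'} {l : c ⟶ c'} {h' : a' ⟶ a''} {k' : b' ⟶ b''} {l' : c' ⟶ c''}
    (σ : Cell i i' h k) (τ : Cell j j' k l) (σ' : Cell i' i'' h' k') (τ' : Cell j' j'' k' l'),
    vCompCell (hComp σ σ') (hComp τ τ') = hComp (vCompCell σ τ) (vCompCell σ' τ')
  vCompCell_mono : ∀ {a b c a' b' c' : Obj} {i : Vert a b} {j : Vert b c} {i' : Vert a' b'}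
    {j' : Vert b' c'} {h h₁ : a ⟶ a'} {k k₁ : b ⟶ b'} {l l₁ : c ⟶ c'}
    {σ : Cell i i' h k} {τ : Cell j j' k l} {σ₁ : Cell i i' h₁ k₁} {τ₁ : Cell j j' k₁ l₁},
    cellLE σ σ₁ → cellLE τ τ₁ → cellLE (vCompCell σ τ) (vCompCell σ₁ τ₁)
  /-- Vertical composition is associative and unital. -/
  vId_comp : ∀ {a b : Obj} (i : Vert a b), vComp (vId a) i = i
  vComp_id : ∀ {a b : Obj} (i : Vert a b), vComp i (vId b) = i
  vComp_assoc : ∀ {a b c d : Obj} (i : Vert a b) (j : Vert b c) (l : Vert c d),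
    vComp (vComp i j) l = vComp i (vComp j l)
  vIdCell_vComp : ∀ {a b a' b' : Obj} {i : Vert a b} {j : Vert a' b'} {h : a ⟶ a'} {k : b ⟶ b'}
    (σ : Cell i j h k), HEq (vCompCell (vIdCell h) σ) σ
  vComp_vIdCell : ∀ {a b a' b' : Obj} {i : Vert a b} {j : Vert a' b'} {h : a ⟶ a'} {k : b ⟶ b'}
    (σ : Cell i j h k), HEq (vCompCell σ (vIdCell k)) σ
  vCompCell_assoc : ∀ {a b c d a' b' c' d' : Obj} {i : Vert a b} {j : Vert b c} {l : Vert c d}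
    {i' : Vert a' b'} {j' : Vert b' c'} {l' : Vert c' d'} {h : a ⟶ a'} {k : b ⟶ b'}
    {m : c ⟶ c'} {n : d ⟶ d'} (σ : Cell i i' h k) (τ : Cell j j' k m) (ω : Cell l l' m n),
    HEq (vCompCell (vCompCell σ τ) ω) (vCompCell σ (vCompCell τ ω))

attribute [instance] PordDouble.cat PordDouble.pord

/-- An internal functor from `J` to the internal category `C² ⇉ C` of squares in `C`.
Monotonicity on the object of arrows follows from `obj_mono`, since cells of squares are pairs of
morphisms of `C` and are compared componentwise. -/
structure PordDouble.ToSq (J : PordDouble.{u}) (C : Type w) [Category.{v} C] [PordCategory C] where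
  obj : J.Obj ⥤ C
  obj_mono : ∀ {a b : J.Obj} {h h' : a ⟶ b}, h ≤ h' → obj.map h ≤ obj.map h'
  vert : ∀ {a b : J.Obj}, J.Vert a b → (obj.obj a ⟶ obj.obj b)
  cell : ∀ {a b a' b' : J.Obj} {i : J.Vert a b} {j : J.Vert a' b'} {h : a ⟶ a'} {k : b ⟶ b'},
    J.Cell i j h k → vert i ≫ obj.map k = obj.map h ≫ vert j
  vert_id : ∀ a : J.Obj, vert (J.vId a) = 𝟙 (obj.obj a)
  vert_comp : ∀ {a b c : J.Obj} (i : J.Vert a b) (j : J.Vert b c),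
    vert (J.vComp i j) = vert i ≫ vert j

/-! ### Lifting structures and cofibrant generation -/

section Lifting

variable {C : Type w} [Category.{u} C] [PordCategory C]

/-- The comparison morphism of preorders `C(T, X) ⟶ C²(i, g)`, `d ↦ (i ≫ d, d ≫ g)`, for
`i : S ⟶ T` and `g : X ⟶ Y`. -/
def liftMap {S T X Y : C} (i : S ⟶ T) (g : X ⟶ Y) :
    Preord.of (T ⟶ X) ⟶ Preord.of (Square i g) :=
  Preord.ofHom
    { toFun := fun d => ⟨i ≫ d, d ≫ g, by simp⟩
      monotone' := fun _ _ hd =>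
        ⟨PordCategory.comp_mono le_rfl hd, PordCategory.comp_mono hd le_rfl⟩ }

/-- `C²(i', g) ⟶ C²(i, g)`, precomposition with a square `i ⟶ i'`. -/
def Square.pre {S T S' T' X Y : C} {i : S ⟶ T} {i' : S' ⟶ T'} (s : Square i i') (g : X ⟶ Y) :
    Preord.of (Square i' g) ⟶ Preord.of (Square i g) :=
  Preord.ofHom
    { toFun := fun t => s.comp t
      monotone' := fun _ _ ht =>
        ⟨PordCategory.comp_mono le_rfl ht.1, PordCategory.comp_mono le_rfl ht.2⟩ }

/-- `C²(i, g) ⟶ C²(i, g')`, postcomposition with a square `g ⟶ g'`. -/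
def Square.post {S T X Y X' Y' : C} (i : S ⟶ T) {g : X ⟶ Y} {g' : X' ⟶ Y'} (s : Square g g') :
    Preord.of (Square i g) ⟶ Preord.of (Square i g') :=
  Preord.ofHom
    { toFun := fun t => t.comp s
      monotone' := fun _ _ ht =>
        ⟨PordCategory.comp_mono ht.1 le_rfl, PordCategory.comp_mono ht.2 le_rfl⟩ }

/-- `liftMap i g` is contravariantly functorial in `i`. -/
def liftMapPre {S T S' T' X Y : C} {i : S ⟶ T} {i' : S' ⟶ T'} (s : Square i i') (g : X ⟶ Y) :
    Square (liftMap i' g) (liftMap i g) where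
  left := Preord.ofHom
    { toFun := fun d => s.right ≫ d
      monotone' := fun _ _ hd => PordCategory.comp_mono le_rfl hd }
  right := s.pre g
  comm := by
    ext d
    · change s.left ≫ i' ≫ d = i ≫ s.right ≫ d
      rw [← Category.assoc, ← s.comm, Category.assoc]
    · change s.right ≫ d ≫ g = (s.right ≫ d) ≫ g
      rw [Category.assoc]

/-- `liftMap i g` is functorial in `g`. -/
def liftMapPost {S T X Y X' Y' : C} (i : S ⟶ T) {g : X ⟶ Y} {g' : X' ⟶ Y'} (s : Square g g') :
    Square (liftMap i g) (liftMap i g') where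
  left := Preord.ofHom
    { toFun := fun d => d ≫ s.left
      monotone' := fun _ _ hd => PordCategory.comp_mono hd le_rfl }
  right := Square.post i s
  comm := by
    ext d
    · change (i ≫ d) ≫ s.left = i ≫ d ≫ s.left
      rw [Category.assoc]
    · change (d ≫ g) ≫ s.right = (d ≫ s.left) ≫ g'
      rw [Category.assoc, s.comm, Category.assoc]

theorem Preord.isPullback_of {P X Y Z : Preord.{u}} {p : P ⟶ X} {q : P ⟶ Y} {f : X ⟶ Z}
    {g : Y ⟶ Z} (w : p ≫ f = q ≫ g) (ex : ∀ x y, f x = g y → ∃ z, p z = x ∧ q z = y)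
    (inj : ∀ z z', p z = p z' → q z = q z' → z = z')
    (le : ∀ z z', p z ≤ p z' → q z ≤ q z' → z ≤ z') : IsPullback p q f g := by
  refine ⟨⟨w⟩, ⟨PullbackCone.IsLimit.mk w (fun s => ?_) ?_ ?_ ?_⟩⟩
  · have hs : ∀ t : s.pt, f (s.fst t) = g (s.snd t) := fun t =>
      ConcreteCategory.congr_hom s.condition t
    exact Preord.ofHom
      { toFun := fun t => (ex _ _ (hs t)).choose
        monotone' := fun t t' h => le _ _
          (by rw [(ex _ _ (hs t)).choose_spec.1, (ex _ _ (hs t')).choose_spec.1]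
              exact s.fst.hom.monotone h)
          (by rw [(ex _ _ (hs t)).choose_spec.2, (ex _ _ (hs t')).choose_spec.2]
              exact s.snd.hom.monotone h) }
  · intro s
    ext t
    exact (ex _ _ (ConcreteCategory.congr_hom s.condition t)).choose_spec.1
  · intro s
    ext t
    exact (ex _ _ (ConcreteCategory.congr_hom s.condition t)).choose_spec.2
  · intro s m h1 h2
    ext t
    refine inj _ _ ?_ ?_
    · exact (ConcreteCategory.congr_hom h1 t).trans
        (ex _ _ (ConcreteCategory.congr_hom s.condition t)).choose_spec.1.symm
    · exact (ConcreteCategory.congr_hom h2 t).trans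
        (ex _ _ (ConcreteCategory.congr_hom s.condition t)).choose_spec.2.symm

/-- `C²(i, f) ⟶ C(T, B)`, `(x, y) ↦ y`, for `i : S ⟶ T` and `f : A ⟶ B`. -/
def squareRight {S T A B : C} (i : S ⟶ T) (f : A ⟶ B) :
    Preord.of (Square i f) ⟶ Preord.of (T ⟶ B) :=
  Preord.ofHom { toFun := fun t => t.right, monotone' := fun _ _ h => h.2 }

/-- `C²(j, g) ⟶ C(T, X)`, `(x, y) ↦ x`, for `j : T ⟶ Z` and `g : X ⟶ Y`. -/
def squareLeft {T Z X Y : C} (j : T ⟶ Z) (g : X ⟶ Y) :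
    Preord.of (Square j g) ⟶ Preord.of (T ⟶ X) :=
  Preord.ofHom { toFun := fun t => t.left, monotone' := fun _ _ h => h.1 }

/-- The square `(1, g) : f ⟶ f ≫ g`. -/
def Square.extend {A B Y : C} (f : A ⟶ B) (g : B ⟶ Y) : Square f (f ≫ g) := ⟨𝟙 A, g, by simp⟩

/-- The square `(f, 1) : f ≫ g ⟶ g`. -/
def Square.drop {A B Y : C} (f : A ⟶ B) (g : B ⟶ Y) : Square (f ≫ g) g := ⟨f, 𝟙 Y, by simp⟩

theorem liftMap_comp_right {S T A B Y : C} (i : S ⟶ T) (f : A ⟶ B) (g : B ⟶ Y) :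
    liftMap i f ≫ Square.post i (Square.extend f g) = liftMap i (f ≫ g) := by
  ext d
  · change (i ≫ d) ≫ 𝟙 A = i ≫ d
    simp
  · change (d ≫ f) ≫ g = d ≫ f ≫ g
    simp

theorem isPullback_right {S T A B Y : C} (i : S ⟶ T) (f : A ⟶ B) (g : B ⟶ Y) :
    IsPullback (squareRight i f) (Square.post i (Square.extend f g)) (liftMap i g)
      (Square.post i (Square.drop f g)) := by
  refine Preord.isPullback_of ?_ ?_ ?_ ?_
  · ext t
    · change i ≫ t.right = (t.left ≫ 𝟙 A) ≫ f
      rw [t.comm, Category.comp_id]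
    · change t.right ≫ g = (t.right ≫ g) ≫ 𝟙 Y
      simp
  · intro x y h
    have h1 : i ≫ x = y.left ≫ f := congrArg Square.left h
    have h2 : x ≫ g = y.right ≫ 𝟙 Y := congrArg Square.right h
    refine ⟨⟨y.left, x, h1⟩, rfl, ?_⟩
    ext
    · exact Category.comp_id _
    · exact h2.trans (Category.comp_id _)
  · intro z z' h1 h2
    have h3 : z.left ≫ 𝟙 A = z'.left ≫ 𝟙 A := congrArg Square.left h2
    ext
    · simpa using h3
    · exact h1
  · intro z z' h1 h2
    have h3 : z.left ≫ 𝟙 A ≤ z'.left ≫ 𝟙 A := h2.1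
    rw [Category.comp_id, Category.comp_id] at h3
    exact ⟨h3, h1⟩

theorem liftMap_comp_left {S T Z X Y : C} (i : S ⟶ T) (j : T ⟶ Z) (g : X ⟶ Y) :
    liftMap j g ≫ (Square.drop i j).pre g = liftMap (i ≫ j) g := by
  ext d
  · change i ≫ j ≫ d = (i ≫ j) ≫ d
    simp
  · change 𝟙 Z ≫ d ≫ g = d ≫ g
    simp

theorem isPullback_left {S T Z X Y : C} (i : S ⟶ T) (j : T ⟶ Z) (g : X ⟶ Y) :
    IsPullback (squareLeft j g) ((Square.drop i j).pre g) (liftMap i g)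
      ((Square.extend i j).pre g) := by
  refine Preord.isPullback_of ?_ ?_ ?_ ?_
  · ext t
    · change i ≫ t.left = 𝟙 S ≫ i ≫ t.left
      simp
    · change t.left ≫ g = j ≫ 𝟙 Z ≫ t.right
      rw [Category.id_comp, t.comm]
  · intro x y h
    have h1 : i ≫ x = 𝟙 S ≫ y.left := congrArg Square.left h
    have h2 : x ≫ g = j ≫ y.right := congrArg Square.right h
    refine ⟨⟨x, y.right, h2.symm⟩, rfl, ?_⟩
    ext
    · exact h1.trans (Category.id_comp _)
    · exact Category.id_comp _
  · intro z z' h1 h2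
    have h3 : 𝟙 Z ≫ z.right = 𝟙 Z ≫ z'.right := congrArg Square.right h2
    ext
    · exact h1
    · simpa using h3
  · intro z z' h1 h2
    have h3 : 𝟙 Z ≫ z.right ≤ 𝟙 Z ≫ z'.right := h2.2
    rw [Category.id_comp, Category.id_comp] at h3
    exact ⟨h1, h3⟩

/-- The composition of lifting structures against a fixed `i`: the `M`-algebra structure on
`liftMap i (f ≫ g)` obtained from `M`-algebra structures on `liftMap i f` and `liftMap i g`. -/
def AWFS.Alg.compRight {EM : AWFS Preord.{u}} {S T A B Y : C} {i : S ⟶ T} {f : A ⟶ B} {g : B ⟶ Y}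
    (φ : EM.Alg (liftMap i f)) (γ : EM.Alg (liftMap i g)) : EM.Alg (liftMap i (f ≫ g)) :=
  liftMap_comp_right i f g ▸ φ.comp (γ.pullback (isPullback_right i f g))

/-- The `M`-algebra structure on `liftMap (i ≫ j) g` obtained from `M`-algebra structures on
`liftMap i g` and `liftMap j g`. -/
def AWFS.Alg.compLeft {EM : AWFS Preord.{u}} {S T Z X Y : C} {i : S ⟶ T} {j : T ⟶ Z} {g : X ⟶ Y}
    (φ : EM.Alg (liftMap i g)) (γ : EM.Alg (liftMap j g)) : EM.Alg (liftMap (i ≫ j) g) :=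
  liftMap_comp_left i j g ▸ γ.comp (φ.pullback (isPullback_left i j g))

/-- For an internal category `J` over the squares of `C` and an AWFS `(E, M)` on preorders, the
objects over `g` of the category of arrows of the internal category of lifting structures against
`J`: an `M`-algebra structure on the transformation `liftMap (U -) g` of presheaves of preorders
on the category of arrows of `J` (i.e. pointwise algebra structures natural with respect to
cells), compatible with the vertical composition of `J`. -/
structure LiftStr (EM : AWFS Preord.{u}) {J : PordDouble.{u}} (U : J.ToSq C) {X Y : C}
    (g : X ⟶ Y) where
  alg : ∀ {a b : J.Obj} (i : J.Vert a b), EM.Alg (liftMap (U.vert i) g)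
  natural : ∀ {a b a' b' : J.Obj} {i : J.Vert a b} {j : J.Vert a' b'} {h : a ⟶ a'} {k : b ⟶ b'}
    (σ : J.Cell i j h k), AWFS.IsAlgHom (alg j) (alg i)
      (liftMapPre (⟨U.obj.map h, U.obj.map k, U.cell σ⟩ : Square (U.vert i) (U.vert j)) g)
  comp : ∀ {a b c : J.Obj} (i : J.Vert a b) (j : J.Vert b c),
    (U.vert_comp i j ▸ alg (J.vComp i j) : EM.Alg (liftMap (U.vert i ≫ U.vert j) g)) =
      (alg i).compLeft (alg j)

/-- The AWFS `W = (L, R)` on `C` is cofibrantly generated, with respect to the AWFS `EM = (E, M)`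
on preorders, by the small internal category `J` over the squares of `C`: the internal category of
`R`-algebras is isomorphic, over the internal category of squares of `C`, to the internal category
of lifting structures against `J`. Both have `C` as object of objects, and on both the category of
arrows is locally a full sub-preorder of `C²`; so an isomorphism over the squares of `C` amounts to
a bijection between structures on each morphism `f` of `C` for which the same squares are
morphisms, and which respects the vertical composition (identities carry a unique structure). -/
def AWFS.IsGeneratedBy (W : AWFS C) (EM : AWFS Preord.{u}) {J : PordDouble.{u}} (U : J.ToSq C) :
    Prop :=
  ∃ e : ∀ {X Y : C} (f : X ⟶ Y), W.Alg f ≃ LiftStr EM U f,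
    (∀ {A B X Y : C} {f : A ⟶ B} {g : X ⟶ Y} (p : W.Alg f) (q : W.Alg g) (s : Square f g),
      AWFS.IsAlgHom p q s ↔ ∀ {a b : J.Obj} (i : J.Vert a b),
        AWFS.IsAlgHom ((e f p).alg i) ((e g q).alg i) (liftMapPost (U.vert i) s)) ∧
    (∀ {A B Y : C} {f : A ⟶ B} {g : B ⟶ Y} (p : W.Alg f) (q : W.Alg g) {a b : J.Obj}
      (i : J.Vert a b),
      (e (f ≫ g) (p.comp q)).alg i = ((e f p).alg i).compRight ((e g q).alg i))

/-- `W` is cofibrantly generated with respect to the AWFS `EM` on preorders: it is generated by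
some small internal category over the squares of `C`. -/
def AWFS.IsCofibrantlyGenerated (W : AWFS C) (EM : AWFS Preord.{u}) : Prop :=
  ∃ (J : PordDouble.{u}) (U : J.ToSq C), W.IsGeneratedBy EM U

end Lifting

/-- An AWFS on preorders is cocontinuous when the functor `K : C² ⥤ C` of its factorisation
preserves small colimits. Only (conical) colimits of ordinary diagrams are required to be
preserved; this is implied by the preservation of all small weighted colimits. -/
def AWFS.IsCocontinuous (EM : AWFS Preord.{u}) : Prop :=
  PreservesColimitsOfSize.{u, u} EM.functor

/-- The underlying WFS of `W` is cofibrantly generated in the usual sense: its right class consists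
of the morphisms with the right lifting property against a small set of morphisms. -/
def AWFS.IsWFSCofibrantlyGenerated {C : Type w} [Category.{u} C] [PordCategory C]
    (W : AWFS C) : Prop :=
  ∃ I : MorphismProperty C, MorphismProperty.IsSmall.{u} I ∧ W.rightClass = I.rlp

/-! ### The AWFS of right adjoints left inverses -/

/-- The order on the lax colimit of a monotone map `f : A → B`: the disjoint union of `A` and `B`
in which moreover `b ≤ a` whenever `b ≤ f a`. -/
inductive LaxColim {A B : Type u} (f : A → B) : Type u
  | inA : A → LaxColim f
  | inB : B → LaxColim f

namespace LaxColim

variable {A B : Type u} [Preorder A] [Preorder B] {f : A →o B}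

protected def LE : LaxColim f → LaxColim f → Prop
  | inA a, inA a' => a ≤ a'
  | inB b, inB b' => b ≤ b'
  | inB b, inA a => b ≤ f a
  | inA _, inB _ => False

instance : Preorder (LaxColim f) where
  le := LaxColim.LE
  le_refl x := by cases x <;> exact le_refl _
  le_trans x y z hxy hyz := by
    cases x <;> cases y <;> cases z <;> simp only [LaxColim.LE] at *
    · exact le_trans hxy hyz
    · exact le_trans hxy (f.monotone hyz)
    · exact le_trans hxy hyz
    · exact le_trans hxy hyz

/-- The morphism from the lax colimit induced by a lax cocone in which the triangle over `B`
commutes up to an inequality. -/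
def desc {Z : Type u} [Preorder Z] (a : A →o Z) (b : B →o Z) (h : ∀ x, b (f x) ≤ a x) :
    LaxColim f →o Z where
  toFun
    | inA x => a x
    | inB y => b y
  monotone' x y hxy := by
    cases x <;> cases y
    · exact a.monotone hxy
    · exact hxy.elim
    · exact le_trans (b.monotone hxy) (h _)
    · exact b.monotone hxy

def incA : A →o LaxColim f := ⟨inA, fun _ _ h => h⟩

def incB : B →o LaxColim f := ⟨inB, fun _ _ h => h⟩

end LaxColim

/-- The functorial factorisation of a monotone map `f : A ⟶ B` through its lax colimit. -/
def raliFunFact : FunFact Preord.{u} where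
  K f := Preord.of (LaxColim f.hom)
  lam f := Preord.ofHom LaxColim.incA
  rho {A B} f := Preord.ofHom (LaxColim.desc f.hom OrderHom.id fun _ => le_rfl)
  fac _ := rfl
  map {A B X Y f g} s := Preord.ofHom (LaxColim.desc (LaxColim.incA.comp s.left.hom)
    (LaxColim.incB.comp s.right.hom) fun x =>
      le_of_eq (α := Y) (ConcreteCategory.congr_hom s.comm x))
  map_id f := by ext x; cases x <;> rfl
  map_comp s t := by ext x; cases x <;> rfl
  map_mono {A B X Y f g s t} h x := by
    cases x with
    | inA a => exact h.1 a
    | inB b => exact h.2 b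
  lam_map _ := rfl
  rho_map s := by
    ext x
    cases x with
    | inA a => exact ConcreteCategory.congr_hom s.comm a
    | inB b => rfl

/-- The AWFS `(E, M)` on preorders whose `M`-algebras are the RALIs: an `M`-algebra structure on
`f : A ⟶ B` amounts to a left adjoint `l : B ⟶ A` of `f` with identity unit, i.e. `f ∘ l = 1` and
`l b ≤ a ↔ b ≤ f a`. -/
def raliAWFS : AWFS Preord.{u} where
  toFunFact := raliFunFact
  sig {A B} f := Preord.ofHom (LaxColim.desc LaxColim.incA (LaxColim.incB.comp LaxColim.incB)
    fun x => le_refl (α := B) (f x))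
  pi {A B} f := Preord.ofHom (LaxColim.desc OrderHom.id LaxColim.incB fun
    | .inA a => le_refl (α := B) (f a)
    | .inB b => le_refl (α := B) b)
  lam_sig f := rfl
  rho_pi f := by ext x; rcases x with (x | x) | x <;> rfl
  sig_nat s := by ext x; cases x <;> rfl
  pi_nat s := by ext x; rcases x with (x | x) | x <;> rfl
  sig_rho f := by ext x; cases x <;> rfl
  sig_copoint f := by ext x; cases x <;> rfl
  sig_coassoc f := by ext x; cases x <;> rfl
  lam_pi f := by ext x; cases x <;> rfl
  point_pi f := by ext x; cases x <;> rfl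
  pi_assoc f := by ext x; rcases x with ((x | x) | x) | x <;> rfl
  distrib f := by ext x; rcases x with (x | x) | x <;> rfl

/-- Cofibrant KZ-generation: cofibrant generation with respect to the AWFS on preorders whose
right algebras are the RALIs. -/
def AWFS.IsCofibrantlyKZGenerated {C : Type w} [Category.{u} C] [PordCategory C]
    (W : AWFS C) : Prop :=
  W.IsCofibrantlyGenerated raliAWFS

/-! ### The AWFS of full maps and complete lattices -/

/-- The underlying preorder of the object `K f`, for `f : A ⟶ B`: pairs `(φ, b)` of a down-closed
subset `φ` of `A` and `b ∈ B` such that `f a ≤ b` for all `a ∈ φ`, ordered componentwise. -/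
abbrev FullK {A B : Type u} [Preorder A] [Preorder B] (f : A → B) : Type u :=
  {x : LowerSet A × B // ∀ a ∈ x.1, f a ≤ x.2}

/-- The direct image `P A → P X` on down-closed subsets along `h : A → X`: the down-closure of the
image. -/
def LowerSet.push {A X : Type u} [Preorder X] [LE A] (h : A → X) (φ : LowerSet A) : LowerSet X :=
  lowerClosure (h '' φ)

theorem LowerSet.mem_push {A X : Type u} [Preorder X] [LE A] {h : A → X} {φ : LowerSet A} {x : X} :
    x ∈ LowerSet.push h φ ↔ ∃ a ∈ φ, x ≤ h a := by
  simp [LowerSet.push]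

/-- The union `⋃ {φ | (φ, b) ∈ Ψ}`. -/
def FullK.join {A B : Type u} [Preorder A] [Preorder B] {f : A → B} (Ψ : LowerSet (FullK f)) :
    LowerSet A :=
  ⨆ y ∈ Ψ, y.1.1

theorem FullK.mem_join {A B : Type u} [Preorder A] [Preorder B] {f : A → B}
    {Ψ : LowerSet (FullK f)} {a : A} : a ∈ FullK.join Ψ ↔ ∃ y ∈ Ψ, a ∈ y.1.1 := by
  simp only [FullK.join, LowerSet.mem_iSup₂_iff, exists_prop]

theorem FullK.ext {A B : Type u} [Preorder A] [Preorder B] {f : A → B} {x y : FullK f}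
    (h1 : ∀ a, a ∈ x.1.1 ↔ a ∈ y.1.1) (h2 : x.1.2 = y.1.2) : x = y :=
  Subtype.ext (Prod.ext (SetLike.ext h1) h2)

/-- The factorisation `f = (A ⟶ K f ⟶ B)`, `a ↦ (↓a, f a)`, `(φ, b) ↦ b`. On a square `(h, k)`
it is given by `(φ, b) ↦ (↓h(φ), k b)`. -/
def fullFunFact : FunFact Preord.{u} where
  K f := Preord.of (FullK f)
  lam {A B} f := Preord.ofHom
    { toFun := fun a => ⟨(LowerSet.Iic a, f a), fun _ h => f.hom.monotone h⟩
      monotone' := fun _ _ h => ⟨fun _ h' => le_trans h' h, f.hom.monotone h⟩ }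
  rho {A B} f := Preord.ofHom { toFun := fun x => x.1.2, monotone' := fun _ _ h => h.2 }
  fac _ := rfl
  map {A B X Y f g} s := Preord.ofHom
    { toFun := fun x => ⟨(LowerSet.push s.left x.1.1, s.right x.1.2), by
        intro y hy
        obtain ⟨a, ha, hya⟩ := LowerSet.mem_push.1 hy
        refine le_trans (g.hom.monotone hya) ?_
        refine le_trans (le_of_eq (ConcreteCategory.congr_hom s.comm a).symm) ?_
        exact s.right.hom.monotone (x.2 a ha)⟩
      monotone' := fun x y h => ⟨by
        intro z hz
        obtain ⟨a, ha, hza⟩ := LowerSet.mem_push.1 hz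
        exact LowerSet.mem_push.2 ⟨a, h.1 ha, hza⟩, s.right.hom.monotone h.2⟩ }
  map_id f := by
    refine Preord.ext fun x => FullK.ext (fun a => ?_) rfl
    exact LowerSet.mem_push.trans ⟨fun ⟨b, hb, h⟩ => x.1.1.lower h hb, fun h => ⟨a, h, le_rfl⟩⟩
  map_comp s t := by
    refine Preord.ext fun x => FullK.ext (fun a => ?_) rfl
    refine LowerSet.mem_push.trans (Iff.trans ?_ LowerSet.mem_push.symm)
    constructor
    · rintro ⟨b, hb, h⟩
      exact ⟨s.left b, LowerSet.mem_push.2 ⟨b, hb, le_rfl⟩, h⟩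
    · rintro ⟨c, hc, h⟩
      obtain ⟨b, hb, h'⟩ := LowerSet.mem_push.1 hc
      exact ⟨b, hb, le_trans h (t.left.hom.monotone h')⟩
  map_mono {A B X Y f g s t} h x := by
    refine ⟨fun z hz => ?_, h.2 _⟩
    obtain ⟨a, ha, hza⟩ := LowerSet.mem_push.1 hz
    exact LowerSet.mem_push.2 ⟨a, ha, le_trans hza (h.1 a)⟩
  lam_map s := by
    refine Preord.ext fun x =>
      FullK.ext (fun a => ?_) (ConcreteCategory.congr_hom s.comm x)
    exact LowerSet.mem_push.trans ⟨fun ⟨b, hb, h⟩ => le_trans h (s.left.hom.monotone hb),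
      fun h => ⟨x, le_refl x, h⟩⟩
  rho_map s := rfl

/-- The lax orthogonal AWFS on preorders whose left maps are the full maps and whose fibrant
objects are the complete lattices. The comultiplication is `(φ, b) ↦ (φ, (φ, b))`, the
multiplication is `(Ψ, b) ↦ (⋃ {φ | (φ, b') ∈ Ψ}, b)`. -/
def fullAWFS : AWFS Preord.{u} where
  toFunFact := fullFunFact
  sig {A B} f := Preord.ofHom
    { toFun := fun x => ⟨(x.1.1, x), fun a ha =>
        ⟨fun _ ha' => x.1.1.lower ha' ha, x.2 a ha⟩⟩
      monotone' := fun _ _ h => ⟨h.1, h⟩ }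
  pi {A B} f := Preord.ofHom
    { toFun := fun x => ⟨(FullK.join x.1.1, x.1.2), fun a ha => by
        obtain ⟨y, hy, hay⟩ := FullK.mem_join.1 ha
        exact le_trans (y.2 a hay) (x.2 y hy)⟩
      monotone' := fun x x' h => ⟨fun a ha => by
        obtain ⟨y, hy, hay⟩ := FullK.mem_join.1 ha
        exact FullK.mem_join.2 ⟨y, h.1 hy, hay⟩, h.2⟩ }
  lam_sig f := rfl
  rho_pi f := rfl
  sig_nat s := rfl
  pi_nat s := by
    refine Preord.ext fun x => FullK.ext (fun a => ?_) rfl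
    refine FullK.mem_join.trans (Iff.trans ?_ LowerSet.mem_push.symm)
    constructor
    · rintro ⟨y, hy, ha⟩
      obtain ⟨z, hz, hyz⟩ := LowerSet.mem_push.1 hy
      obtain ⟨c, hc, hac⟩ := LowerSet.mem_push.1 (hyz.1 ha)
      exact ⟨c, FullK.mem_join.2 ⟨z, hz, hc⟩, hac⟩
    · rintro ⟨c, hc, hac⟩
      obtain ⟨z, hz, hcz⟩ := FullK.mem_join.1 hc
      exact ⟨fullFunFact.map s z, LowerSet.mem_push.2 ⟨z, hz, le_rfl⟩,
        LowerSet.mem_push.2 ⟨c, hcz, hac⟩⟩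
  sig_rho f := rfl
  sig_copoint f := by
    refine Preord.ext fun x => FullK.ext (fun a => ?_) rfl
    exact LowerSet.mem_push.trans ⟨fun ⟨b, hb, h⟩ => x.1.1.lower h hb, fun h => ⟨a, h, le_rfl⟩⟩
  sig_coassoc f := by
    refine Preord.ext fun x => FullK.ext (fun a => ?_) rfl
    exact Iff.trans ⟨fun h => ⟨a, h, le_rfl⟩, fun ⟨b, hb, h⟩ => x.1.1.lower h hb⟩
      LowerSet.mem_push.symm
  lam_pi f := by
    refine Preord.ext fun x => FullK.ext (fun a => ?_) rfl
    exact FullK.mem_join.trans ⟨fun ⟨y, hy, h⟩ => hy.1 h, fun h => ⟨x, le_refl x, h⟩⟩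
  point_pi {A B} f := by
    refine Preord.ext fun x => FullK.ext (fun a => ?_) rfl
    refine FullK.mem_join.trans ⟨?_, fun h => ?_⟩
    · rintro ⟨y, hy, h⟩
      obtain ⟨b, hb, hyb⟩ := LowerSet.mem_push.1 hy
      exact x.1.1.lower (hyb.1 h) hb
    · exact ⟨fullFunFact.lam f a, LowerSet.mem_push.2 ⟨a, h, le_rfl⟩, le_refl a⟩
  pi_assoc f := by
    refine Preord.ext fun x => FullK.ext (fun a => ?_) rfl
    refine FullK.mem_join.trans (Iff.trans ?_ FullK.mem_join.symm)
    constructor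
    · rintro ⟨y, hy, h⟩
      obtain ⟨z, hz, hyz⟩ := FullK.mem_join.1 hy
      exact ⟨⟨(FullK.join z.1.1, z.1.2), _⟩, LowerSet.mem_push.2 ⟨z, hz, le_rfl⟩,
        FullK.mem_join.2 ⟨y, hyz, h⟩⟩
    · rintro ⟨y, hy, h⟩
      obtain ⟨z, hz, hyz⟩ := LowerSet.mem_push.1 hy
      obtain ⟨t, ht, hat⟩ := FullK.mem_join.1 (hyz.1 h)
      exact ⟨t, FullK.mem_join.2 ⟨z, hz, ht⟩, hat⟩
  distrib f := by
    refine Preord.ext fun x => FullK.ext (fun a => ?_) rfl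
    refine FullK.mem_join.trans (Iff.trans ?_ FullK.mem_join.symm)
    constructor
    · rintro ⟨y, hy, h⟩
      exact ⟨⟨(y.1.1, y), fun a ha => ⟨fun _ ha' => y.1.1.lower ha' ha, y.2 a ha⟩⟩,
        LowerSet.mem_push.2 ⟨y, hy, le_rfl⟩, h⟩
    · rintro ⟨y, hy, h⟩
      obtain ⟨z, hz, hyz⟩ := LowerSet.mem_push.1 hy
      exact ⟨z, hz, hyz.1 h⟩

/-- A map of preorders is full if it is full as a functor. -/
def Preord.IsFull {A B : Preord.{u}} (f : A ⟶ B) : Prop :=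
  ∀ a a' : A, f a ≤ f a' → a ≤ a'

/-- The morphism from `X` to the terminal (one-point) preorder. -/
def Preord.toOne (X : Preord.{u}) : X ⟶ Preord.of PUnit.{u + 1} :=
  Preord.ofHom ⟨fun _ => PUnit.unit, fun _ _ _ => le_rfl⟩

/-- The square from `X ⟶ 1` to `Y ⟶ 1` determined by `h : X ⟶ Y`. -/
def Preord.toOneSquare {X Y : Preord.{u}} (h : X ⟶ Y) : Square X.toOne Y.toOne :=
  ⟨h, 𝟙 _, rfl⟩

/-- A preorder is a complete lattice if it is a poset in which every subset has a supremum. -/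
def Preord.IsCompleteLattice (X : Preord.{u}) : Prop :=
  (∀ x y : X, x ≤ y → y ≤ x → x = y) ∧ ∀ s : Set X, ∃ x, IsLUB s x

/-- The chain `μ ↦ succ μ = {ν | ν ≤ μ}` of initial segments of a preorder, with the inclusions. -/
def Preord.succChain (β : Type u) [Preorder β] : β ⥤ Preord.{u} where
  obj μ := Preord.of (Set.Iic μ)
  map h := Preord.ofHom ⟨fun x => ⟨x.1, le_trans x.2 (leOfHom h)⟩, fun _ _ h => h⟩

/-- The cocone of inclusions `succ μ ⊆ β`. -/
def Preord.succCocone (β : Type u) [Preorder β] : Cocone (Preord.succChain β) where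
  pt := Preord.of β
  ι := { app := fun _ => Preord.ofHom ⟨fun x => x.1, fun _ _ h => h⟩ }

end

/-! ### The elementary properties of the AWFS of full maps -/

/-! Positive part. Over `1`, a structure map is a monotone retraction `p` of `a ↦ ↓a`. Comparing `φ`
with `↓a` for `a ∈ φ` and with `↓b` for an upper bound `b` forces `p φ` to be a supremum of `φ`
(`isLUB_of_lam_comp`). So the unit law alone gives a complete lattice, suprema conversely satisfy
the associativity law, and homomorphisms are the sup-preserving maps. On the left, `lam f` reflects
the order, so a monotone `s` with `f ≫ s = lam f` forces `f` to be full; a full `f` has the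
coalgebra `b ↦ ({a | f a ≤ b}, b)`.

Negative part. A regular cardinal `β` is the union of the complete lattices `succ μ` along
sup-preserving inclusions, but has no greatest element. Any notion of structure defined by lifting
against a small amount of data cannot see this: once `β` exceeds the sizes involved, a map from a
small preorder to `β` lands in some `succ μ`.

For algebraic generation the property needed of `(E, M)` is `PreservesPointwiseColimits`. It lets
`M`-algebra structures glue along colimits of arrows (`exists_alg`), and lets homomorphism
conditions be tested on the legs. The comparison map of `i` and `β ⟶ 1` is the pointwise colimit of
those for `succ μ ⟶ 1`, so the lifting structures on the `succ μ` glue to one on `β ⟶ 1`. This would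
make `β` a complete lattice. Cocontinuous AWFSs have the property by definition; the RALI one has it
because its `K` is itself a lax colimit. For the plain WFS the same chain is used with one lifting
problem at a time. -/

theorem fullAWFS_isLaxOrthogonal : fullAWFS.{u}.IsLaxOrthogonal := by
  refine ⟨fun {A B} f => ⟨fun x => ⟨fun y hy => ?_, le_refl _⟩, le_refl _⟩,
    fun {A B} f => ⟨le_refl _, fun x => ⟨fun a ha => ?_, le_refl _⟩⟩⟩
  -- For `a ∈ φ` the element `(↓a, f a)` lies below `(φ, b)`, so the image of `φ` lies in the
  -- principal down-set of `(φ, b)`.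
  · obtain ⟨a, ha, hya⟩ := LowerSet.mem_push.1 hy
    exact le_trans hya ⟨fun b hb => x.1.1.lower hb ha, x.2 a ha⟩
  -- An element `(φ, (ψ, b))` of `K (lam f)` satisfies `φ ⊆ ψ`, because `↓a ⊆ ψ` for each `a ∈ φ`.
  · obtain ⟨b, hb, hab⟩ := LowerSet.mem_push.1 ha
    exact (x.2 b hb).1 hab

theorem Preord.IsFull.of_leftClass {A B : Preord.{u}} {f : A ⟶ B} (hf : fullAWFS.leftClass f) :
    Preord.IsFull f := by
  obtain ⟨s, hs, -⟩ := hf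
  intro a a' h
  have h1 : fullAWFS.lam f a ≤ fullAWFS.lam f a' := by
    rw [← hs]
    exact s.hom.monotone h
  exact h1.1 (le_refl a)

/-- The coalgebra structure `b ↦ ({a | f a ≤ b}, b)` on a full map. -/
noncomputable def Preord.IsFull.coalg {A B : Preord.{u}} {f : A ⟶ B} (hf : Preord.IsFull f) :
    fullAWFS.Coalg f where
  str := Preord.ofHom
    { toFun := fun b => ⟨(⟨{a | f a ≤ b}, fun _ _ h h' => le_trans (f.hom.monotone h) h'⟩, b),
        fun _ h => h⟩
      monotone' := fun _ _ h => ⟨fun _ h' => le_trans h' h, h⟩ }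
  comm := Preord.ext fun a =>
    FullK.ext (fun a' => ⟨fun h => hf a' a h, fun h => f.hom.monotone h⟩) rfl
  counit := rfl
  coassoc := by
    refine Preord.ext fun b => FullK.ext (fun a => ?_) rfl
    exact Iff.trans ⟨fun h => ⟨a, h, le_rfl⟩,
      fun ⟨c, hc, h⟩ => le_trans (f.hom.monotone h) hc⟩ LowerSet.mem_push.symm

theorem AWFS.Coalg.leftClass {C : Type w} [Category.{v} C] [PordCategory C] {W : AWFS C}
    {A B : C} {f : A ⟶ B} (c : W.Coalg f) : W.leftClass f :=
  ⟨c.str, by rw [c.comm, Category.id_comp], c.counit⟩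

theorem AWFS.Alg.rightClass {C : Type w} [Category.{v} C] [PordCategory C] {W : AWFS C}
    {A B : C} {f : A ⟶ B} (p : W.Alg f) : W.rightClass f :=
  ⟨p.str, p.unit, by rw [← p.comm, Category.comp_id]⟩

theorem leftClass_iff_isFull {A B : Preord.{u}} (f : A ⟶ B) :
    fullAWFS.leftClass f ↔ Preord.IsFull f :=
  ⟨.of_leftClass, fun hf => hf.coalg.leftClass⟩

theorem nonempty_coalg_iff_isFull {A B : Preord.{u}} (f : A ⟶ B) :
    Nonempty (fullAWFS.Coalg f) ↔ Preord.IsFull f :=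
  ⟨fun ⟨c⟩ => .of_leftClass c.leftClass, fun hf => ⟨hf.coalg⟩⟩

/-! ### Algebras over the terminal preorder and complete lattices -/

/-- A down-closed subset of `X`, as an element of `K (X ⟶ 1)`. -/
def fullKMk {X : Preord.{u}} (φ : LowerSet X) : FullK X.toOne :=
  ⟨(φ, PUnit.unit), fun _ _ => le_rfl⟩

/-- Monotonicity of `p` applied to `↓a ≤ φ` for `a ∈ φ`, and to `φ ≤ ↓b` for an upper bound `b`,
squeezes `p φ` into being a least upper bound. The associativity law plays no role, which is why
algebras for the monad and for the pointed endofunctor exist on the same `X ⟶ 1`. -/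
theorem isLUB_of_lam_comp {X : Preord.{u}} {p : fullAWFS.K X.toOne ⟶ X}
    (hp : fullAWFS.lam X.toOne ≫ p = 𝟙 X) (φ : LowerSet X) :
    IsLUB (φ : Set X) (p (fullKMk φ)) := by
  have key : ∀ a : X, p (fullKMk (LowerSet.Iic a)) = a := fun a => ConcreteCategory.congr_hom hp a
  refine ⟨fun a ha => ?_, fun b hb => ?_⟩
  · have h : fullKMk (LowerSet.Iic a) ≤ fullKMk φ :=
      ⟨fun c hc => φ.lower (show c ≤ a from hc) ha, le_rfl⟩
    simpa [key] using p.hom.monotone h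
  · have h : fullKMk φ ≤ fullKMk (LowerSet.Iic b) := ⟨fun c hc => hb hc, le_rfl⟩
    simpa [key] using p.hom.monotone h

theorem isLUB_lowerClosure {X : Type u} [Preorder X] {s : Set X} {x : X} :
    IsLUB (lowerClosure s : Set X) x ↔ IsLUB s x := by
  simp [IsLUB]

theorem Preord.IsCompleteLattice.of_rightClass {X : Preord.{u}}
    (h : fullAWFS.rightClass X.toOne) : X.IsCompleteLattice := by
  obtain ⟨p, hp, -⟩ := h
  refine ⟨fun x y hxy hyx => ?_, fun s => ⟨_, isLUB_lowerClosure.1 (isLUB_of_lam_comp hp _)⟩⟩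
  -- Antisymmetry: equivalent elements have the same principal down-set, and the retraction recovers
  -- each of them from it.
  have h1 : fullAWFS.lam X.toOne x = fullAWFS.lam X.toOne y :=
    FullK.ext (fun a => ⟨fun h => le_trans (show a ≤ x from h) hxy,
      fun h => le_trans (show a ≤ y from h) hyx⟩) rfl
  have h2 : ∀ a : X, p (fullAWFS.lam X.toOne a) = a := fun a => ConcreteCategory.congr_hom hp a
  rw [← h2 x, h1, h2]

theorem Preord.IsCompleteLattice.isLUB_unique {X : Preord.{u}} (hX : X.IsCompleteLattice)
    {s : Set X} {x y : X} (hx : IsLUB s x) (hy : IsLUB s y) : x = y :=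
  hX.1 _ _ (hx.2 hy.1) (hy.2 hx.1)

/-- The algebra structure on a complete lattice, given by suprema. -/
noncomputable def Preord.IsCompleteLattice.alg {X : Preord.{u}} (hX : X.IsCompleteLattice) :
    fullAWFS.Alg X.toOne where
  str := Preord.ofHom
    { toFun := fun x => (hX.2 (x.1.1 : Set X)).choose
      monotone' := fun x y h => (hX.2 (x.1.1 : Set X)).choose_spec.2
        fun _ ha => (hX.2 (y.1.1 : Set X)).choose_spec.1 (h.1 ha) }
  comm := rfl
  unit := Preord.ext fun a =>
    hX.isLUB_unique (hX.2 (LowerSet.Iic a : Set X)).choose_spec isLUB_Iic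
  assoc := by
    refine Preord.ext fun x => hX.isLUB_unique (hX.2 _).choose_spec ?_
    -- Associativity is the rule that the supremum of the suprema of the members of a family is the
    -- supremum of their union.
    refine isLUB_lowerClosure.2 ⟨?_, fun b hb => ?_⟩
    · rintro _ ⟨y, hy, rfl⟩
      exact (hX.2 _).choose_spec.2 fun a ha =>
        (hX.2 _).choose_spec.1 (FullK.mem_join.2 ⟨y, hy, ha⟩)
    · refine (hX.2 _).choose_spec.2 fun a ha => ?_
      obtain ⟨y, hy, hay⟩ := FullK.mem_join.1 ha
      exact le_trans ((hX.2 (y.1.1 : Set X)).choose_spec.1 hay) (hb ⟨y, hy, rfl⟩)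

theorem rightClass_toOne_iff (X : Preord.{u}) :
    fullAWFS.rightClass X.toOne ↔ X.IsCompleteLattice :=
  ⟨.of_rightClass, fun hX => hX.alg.rightClass⟩

theorem nonempty_alg_toOne_iff (X : Preord.{u}) :
    Nonempty (fullAWFS.Alg X.toOne) ↔ X.IsCompleteLattice :=
  ⟨fun ⟨p⟩ => .of_rightClass p.rightClass, fun hX => ⟨hX.alg⟩⟩

/-- Both structure maps compute suprema of down-closed sets, so the homomorphism equation says that
`h` preserves these. Arbitrary subsets follow, since a set and its down-closure have the same upper
bounds, also after applying the monotone map `h`. -/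
theorem isAlgHom_toOneSquare_iff {X Y : Preord.{u}} (p : fullAWFS.Alg X.toOne)
    (q : fullAWFS.Alg Y.toOne) (h : X ⟶ Y) :
    AWFS.IsAlgHom p q (Preord.toOneSquare h) ↔
      ∀ (s : Set X) (x : X), IsLUB s x → IsLUB (h '' s) (h x) := by
  have hX := Preord.IsCompleteLattice.of_rightClass p.rightClass
  have hY := Preord.IsCompleteLattice.of_rightClass q.rightClass
  have hq : ∀ φ : LowerSet X,
      IsLUB (h '' φ) (q.str (fullAWFS.map (Preord.toOneSquare h) (fullKMk φ))) :=
    fun φ => isLUB_lowerClosure.1 (isLUB_of_lam_comp q.unit (LowerSet.push h φ))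
  constructor
  · intro hpq s x hx
    have e := ConcreteCategory.congr_hom hpq (fullKMk (lowerClosure s))
    have ex : p.str (fullKMk (lowerClosure s)) = x :=
      hX.isLUB_unique (isLUB_of_lam_comp p.unit _) (isLUB_lowerClosure.2 hx)
    have e' : h x = q.str (fullAWFS.map (Preord.toOneSquare h) (fullKMk (lowerClosure s))) := by
      rw [← ex]
      exact e
    rw [e']
    refine ⟨?_, fun b hb => (hq _).2 ?_⟩
    · rintro _ ⟨a, ha, rfl⟩
      exact (hq _).1 ⟨a, subset_lowerClosure ha, rfl⟩
    · rintro _ ⟨a, ⟨c, hc, hac⟩, rfl⟩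
      exact le_trans (h.hom.monotone hac) (hb ⟨c, hc, rfl⟩)
  · intro hh
    refine Preord.ext fun x => ?_
    exact hY.isLUB_unique (hh _ _ (isLUB_of_lam_comp p.unit x.1.1)) (hq x.1.1)

/-! ### Unions of preorders -/

/-- A cocone over a directed diagram of preorders is colimiting if its legs reflect the order, are
injective, and are jointly surjective. -/
theorem Preord.nonempty_isColimit_of_union {J : Type u} [Preorder J] [IsDirectedOrder J]
    {F : J ⥤ Preord.{u}} (c : Cocone F)
    (inj : ∀ j (x y : F.obj j), c.ι.app j x = c.ι.app j y → x = y)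
    (refl : ∀ j (x y : F.obj j), c.ι.app j x ≤ c.ι.app j y → x ≤ y)
    (surj : ∀ z : c.pt, ∃ j x, c.ι.app j x = z) : Nonempty (IsColimit c) := by
  choose d r hr using surj
  have hw : ∀ {j k : J} (m : j ⟶ k) (x : F.obj j), c.ι.app k (F.map m x) = c.ι.app j x :=
    fun m x => ConcreteCategory.congr_hom (c.w m) x
  have hsw : ∀ (s : Cocone F) {j k : J} (m : j ⟶ k) (x : F.obj j),
      s.ι.app k (F.map m x) = s.ι.app j x :=
    fun s {_ _} m x => ConcreteCategory.congr_hom (s.w m) x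
  have fac : ∀ (s : Cocone F) (j : J) (x : F.obj j),
      s.ι.app (d (c.ι.app j x)) (r (c.ι.app j x)) = s.ι.app j x := by
    intro s j x
    -- The chosen representative and `x` are moved to a common stage, where injectivity of the leg
    -- identifies them; so the choice is harmless.
    obtain ⟨k, hk, hk'⟩ := exists_ge_ge (d (c.ι.app j x)) j
    rw [← hsw s (homOfLE hk), ← hsw s (homOfLE hk')]
    congr 1
    apply inj
    rw [hw, hw, hr]
  have mono : ∀ (s : Cocone F) (x y : c.pt), x ≤ y → s.ι.app (d x) (r x) ≤ s.ι.app (d y) (r y) := by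
    intro s x y h
    obtain ⟨k, hk, hk'⟩ := exists_ge_ge (d x) (d y)
    rw [← hsw s (homOfLE hk), ← hsw s (homOfLE hk')]
    refine (s.ι.app k).hom.monotone (refl k _ _ ?_)
    rwa [hw, hw, hr, hr]
  exact ⟨{
    desc := fun s => Preord.ofHom ⟨fun x => s.ι.app (d x) (r x), fun x y h => mono s x y h⟩
    fac := fun s j => Preord.ext fun x => fac s j x
    uniq := fun s m hm => Preord.ext fun x => by
      have h := ConcreteCategory.congr_hom (hm (d x)) (r x)
      have h' : m (c.ι.app (d x) (r x)) = s.ι.app (d x) (r x) := h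
      rw [hr] at h'
      exact h' }⟩

/-- The legs of a colimit cocone of preorders are jointly surjective. -/
theorem Preord.exists_of_isColimit {J : Type w} [Category.{v} J] {F : J ⥤ Preord.{u}}
    {c : Cocone F} (hc : IsColimit c) (z : c.pt) : ∃ j x, c.ι.app j x = z := by
  -- In the indiscrete preorder on `Prop` every function is monotone. The indicator of the union of
  -- the images of the legs and the constant `True` agree on every leg, hence everywhere.
  let : Preorder (ULift.{u} Prop) :=
    { le := fun _ _ => True
      lt := fun _ _ => False
      lt_iff_le_not_ge := fun _ _ => by simp
      le_refl := fun _ => trivial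
      le_trans := fun _ _ _ _ _ => trivial }
  let a : c.pt ⟶ Preord.of (ULift.{u} Prop) :=
    Preord.ofHom ⟨fun z => ⟨∃ j x, c.ι.app j x = z⟩, fun _ _ _ => trivial⟩
  let b : c.pt ⟶ Preord.of (ULift.{u} Prop) :=
    Preord.ofHom ⟨fun _ => ⟨True⟩, fun _ _ _ => trivial⟩
  have hab : a = b := by
    refine hc.hom_ext fun j => Preord.ext fun x => ?_
    exact congrArg ULift.up (eq_true ⟨j, x, rfl⟩)
  have h := congrArg ULift.down (ConcreteCategory.congr_hom hab z)
  exact of_eq_true h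

/-! ### Regular cardinals as unions of complete lattices -/

section Chain

variable (β : Cardinal.{u}) [Fact β.IsRegular]

/-- The top element `μ` bounds every subset, and well-foundedness picks a least element among the
upper bounds. -/
theorem Preord.succChain_isCompleteLattice {α : Type u} [LinearOrder α] [WellFoundedLT α] (μ : α) :
    ((Preord.succChain α).obj μ).IsCompleteLattice := by
  refine ⟨fun x y h h' => Subtype.ext (le_antisymm h h'), fun s => ?_⟩
  have hne : (upperBounds s).Nonempty := ⟨⟨μ, le_refl μ⟩, fun x _ => x.2⟩
  let t : Set α := Subtype.val '' upperBounds s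
  have ht : t.Nonempty := hne.image _
  obtain ⟨x, hx, hmin⟩ := WellFounded.has_min (wellFounded_lt (α := α)) t ht
  obtain ⟨x, hxs, rfl⟩ := hx
  exact ⟨x, hxs, fun y hy => not_lt.1 (hmin _ ⟨y, hy, rfl⟩)⟩

/-- An upper bound in the larger segment either lies in the smaller one already or is above `μ`,
hence above the supremum formed there. -/
theorem Preord.succChain_map_isLUB {α : Type u} [LinearOrder α] {μ ν : α} (h : μ ⟶ ν)
    (s : Set ((Preord.succChain α).obj μ)) (x : (Preord.succChain α).obj μ) (hx : IsLUB s x) :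
    IsLUB ((Preord.succChain α).map h '' s) ((Preord.succChain α).map h x) := by
  refine ⟨?_, fun y hy => ?_⟩
  · rintro _ ⟨a, ha, rfl⟩
    exact hx.1 ha
  · rcases le_total y.1 μ with hyμ | hyμ
    · have hub : (⟨y.1, hyμ⟩ : Set.Iic μ) ∈ upperBounds s := fun a ha => hy ⟨a, ha, rfl⟩
      exact hx.2 hub
    · exact (le_trans (show x.1 ≤ μ from x.2) hyμ : x.1 ≤ y.1)

theorem Preord.nonempty_isColimit_succCocone (α : Type u) [LinearOrder α] :
    Nonempty (IsColimit (Preord.succCocone α)) :=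
  Preord.nonempty_isColimit_of_union _ (fun _ _ _ h => Subtype.ext h) (fun _ _ _ h => h)
    fun z => ⟨z, ⟨z, le_refl z⟩, rfl⟩

/-- A supremum of the whole set would be a greatest element, but an infinite cardinal is a limit
ordinal. -/
theorem Preord.not_isCompleteLattice_ord :
    ¬ (Preord.of β.ord.ToType).IsCompleteLattice := by
  intro h
  obtain ⟨x, hx⟩ := h.2 Set.univ
  have : NoMaxOrder β.ord.ToType := Cardinal.noMaxOrder (Fact.out : β.IsRegular).aleph0_le
  obtain ⟨y, hy⟩ := exists_gt (α := β.ord.ToType) x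
  exact not_lt_of_ge (hx.1 (Set.mem_univ y) : (y : β.ord.ToType) ≤ x) hy

/-- This is where regularity enters, through the `β`-filteredness of the ordinal. -/
theorem Cardinal.exists_forall_le_of_mk_lt {S : Type u} (hS : Cardinal.mk S < β)
    (f : S → β.ord.ToType) : ∃ μ, ∀ s, f s ≤ μ := by
  have h : HasCardinalLT S β := by rwa [hasCardinalLT_iff_cardinal_mk_lt]
  exact ⟨IsCardinalFiltered.max f h, fun s => leOfHom (IsCardinalFiltered.toMax f h s)⟩

theorem Cardinal.exists_isRegular_mk_lt (S : Type u) :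
    ∃ β : Cardinal.{u}, β.IsRegular ∧ Cardinal.mk S < β :=
  ⟨Order.succ (max Cardinal.aleph0 (Cardinal.mk S)), Cardinal.isRegular_succ (le_max_left _ _),
    Order.lt_succ_of_le (le_max_right _ _)⟩

end Chain

namespace AWFS

variable {C : Type w} [Category.{v} C] [PordCategory C] {W : AWFS C}

/-! ### Functoriality of the constructions on algebras -/

theorem IsAlgHom.comp {A B X Y Z T : C} {f : A ⟶ B} {g : X ⟶ Y} {h : Z ⟶ T} {p : W.Alg f}
    {q : W.Alg g} {r : W.Alg h} {s : Square f g} {t : Square g h} (hs : IsAlgHom p q s)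
    (ht : IsAlgHom q r t) : IsAlgHom p r (s.comp t) := by
  unfold IsAlgHom at *
  rw [Square.comp_left, ← Category.assoc, hs, Category.assoc, ht, map_map_assoc]

/-- If the squares `t j` are jointly epimorphic after applying `K`, being a morphism of algebras
may be checked after precomposition with them. -/
theorem IsAlgHom.of_jointly_epi {J : Type*} {S T : J → C} {f : ∀ j, S j ⟶ T j} {A B X Y : C}
    {g : A ⟶ B} {h : X ⟶ Y} {t : ∀ j, Square (f j) g}
    (epi : ∀ {Z : C} (a b : W.K g ⟶ Z), (∀ j, W.map (t j) ≫ a = W.map (t j) ≫ b) → a = b)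
    {p : ∀ j, W.Alg (f j)} {q : W.Alg g} {r : W.Alg h} (hp : ∀ j, IsAlgHom (p j) q (t j))
    {s : Square g h} (hs : ∀ j, IsAlgHom (p j) r ((t j).comp s)) : IsAlgHom q r s := by
  refine epi _ _ fun j => ?_
  have h1 := hp j
  have h2 := hs j
  unfold IsAlgHom at h1 h2
  rw [← Category.assoc, ← h1, map_map_assoc, ← h2, Square.comp_left, Category.assoc]

/-- Turns an equality of structures into a homomorphism statement, which can then be tested on the
legs of a colimit. -/
theorem IsAlgHom.eq_of_id {A B : C} {f : A ⟶ B} {p q : W.Alg f}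
    (h : IsAlgHom p q (Square.id f)) : p = q := by
  unfold IsAlgHom at h
  rw [W.map_id] at h
  ext
  simpa using h

/-- Vertical composition is functorial, by naturality of `sig` and the two homomorphism equations.
The pasted square `r` is given through its components, so that it need not be a syntactic pasting.
-/
theorem Alg.comp_isAlgHom {A B Y A' B' Y' : C} {f : A ⟶ B} {g : B ⟶ Y} {f' : A' ⟶ B'}
    {g' : B' ⟶ Y'} {p : W.Alg f} {q : W.Alg g} {p' : W.Alg f'} {q' : W.Alg g'}
    {s : Square f f'} {t : Square g g'} (hp : IsAlgHom p p' s) (hq : IsAlgHom q q' t)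
    (hst : s.right = t.left) (r : Square (f ≫ g) (f' ≫ g')) (hr : r.left = s.left)
    (hr' : r.right = t.right) : IsAlgHom (p.comp q) (p'.comp q') r := by
  unfold IsAlgHom at *
  change (W.sig (f ≫ g) ≫ W.map q.compSquare ≫ p.str) ≫ r.left =
    W.map r ≫ W.sig (f' ≫ g') ≫ W.map q'.compSquare ≫ p'.str
  rw [map_sig_assoc, map_map_assoc, Category.assoc, Category.assoc, hr, hp, map_map_assoc]
  congr 3
  ext
  · simp [Alg.compSquare, FunFact.mapL, hr]
  · simp only [Square.comp_right, Alg.compSquare, FunFact.mapL]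
    rw [Category.assoc, hst, hq, map_map_assoc, map_map_assoc]
    congr 2
    ext
    · simp only [Square.comp_left]
      rw [← hst, s.comm, hr]
    · simp [hr']

theorem Alg.pullback_isAlgHom_of {A B X Y A' B' X' Y' : C} {f : A ⟶ B} {g : X ⟶ Y}
    {f' : A' ⟶ B'} {g' : X' ⟶ Y'} {q : W.Alg g} {q' : W.Alg g'} {h : A ⟶ X} {k : B ⟶ Y}
    {h' : A' ⟶ X'} {k' : B' ⟶ Y'} (sq : IsPullback h f g k) (sq' : IsPullback h' f' g' k')
    {t : Square g g'} (ht : IsAlgHom q q' t) (s : Square f f') (hl : s.left ≫ h' = h ≫ t.left)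
    (hr : s.right ≫ k' = k ≫ t.right) : IsAlgHom (q.pullback sq) (q'.pullback sq') s := by
  have e1 := q.pullback_isAlgHom sq
  have e2 := q'.pullback_isAlgHom sq'
  unfold IsAlgHom at *
  simp only at e1 e2
  apply sq'.hom_ext
  · rw [Category.assoc, Category.assoc, hl, e2, ← Category.assoc, e1, Category.assoc, ht,
      map_map_assoc, map_map_assoc]
    congr 2
    ext
    · simp [hl]
    · simp [hr]
  · have e3 : (q.pullback sq).str ≫ f = W.rho f := by rw [← (q.pullback sq).comm, Category.comp_id]
    have e4 : (q'.pullback sq').str ≫ f' = W.rho f' := by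
      rw [← (q'.pullback sq').comm, Category.comp_id]
    rw [Category.assoc, Category.assoc, ← s.comm, ← Category.assoc, e3, e4, W.rho_map]

theorem isAlgHom_cast {A B X Y : C} {f f₁ : A ⟶ B} {g g₁ : X ⟶ Y} (hf : f = f₁) (hg : g = g₁)
    {p : W.Alg f} {q : W.Alg g} {s : Square f g} (hs : IsAlgHom p q s) (s₁ : Square f₁ g₁)
    (hl : s₁.left = s.left) (hr : s₁.right = s.right) : IsAlgHom (hf ▸ p) (hg ▸ q) s₁ := by
  subst hf hg
  obtain rfl : s₁ = s := Square.ext hl hr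
  exact hs

end AWFS

/-! ### Functoriality of composite lifting structures in the target -/

section Lifting

variable {C : Type w} [Category.{u} C] [PordCategory C] {EM : AWFS Preord.{u}}

/-- Combines the functoriality of pullback and of vertical composition of algebras, after removing
the transport in `compLeft`. It serves to carry the vertical composition axiom from the stages of
the chain to the union. -/
theorem AWFS.Alg.compLeft_isAlgHom {S T Z X Y X' Y' : C} {i : S ⟶ T} {j : T ⟶ Z} {g : X ⟶ Y}
    {g' : X' ⟶ Y'} {φ : EM.Alg (liftMap i g)} {γ : EM.Alg (liftMap j g)}
    {φ' : EM.Alg (liftMap i g')} {γ' : EM.Alg (liftMap j g')} {s : Square g g'}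
    (hφ : AWFS.IsAlgHom φ φ' (liftMapPost i s)) (hγ : AWFS.IsAlgHom γ γ' (liftMapPost j s)) :
    AWFS.IsAlgHom (φ.compLeft γ) (φ'.compLeft γ') (liftMapPost (i ≫ j) s) := by
  have hpre : Square.post j s ≫ (Square.drop i j).pre g' =
      (Square.drop i j).pre g ≫ Square.post (i ≫ j) s :=
    Preord.ext fun t => Square.ext (Category.assoc _ _ _).symm (Category.assoc _ _ _).symm
  refine AWFS.isAlgHom_cast (liftMap_comp_left i j g) (liftMap_comp_left i j g')
    (s := ⟨(liftMapPost j s).left, Square.post (i ≫ j) s, ?_⟩) ?_ _ rfl rfl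
  · rw [Category.assoc, ← hpre, ← Category.assoc]
    erw [(liftMapPost j s).comm]
    rw [Category.assoc]
  · refine AWFS.Alg.comp_isAlgHom (s := liftMapPost j s) (t := ⟨_, _, hpre.symm⟩) hγ ?_ rfl _
      rfl rfl
    refine AWFS.Alg.pullback_isAlgHom_of _ _ hφ _ rfl ?_
    exact Preord.ext fun t => Square.ext (Category.assoc _ _ _).symm (Category.assoc _ _ _).symm

theorem AWFS.isAlgHom_liftMapPost_cast {S T X Y X' Y' : C} {i j : S ⟶ T} (h : i = j) {g : X ⟶ Y}
    {g' : X' ⟶ Y'} {p : EM.Alg (liftMap i g)} {q : EM.Alg (liftMap i g')} {s : Square g g'}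
    (hs : AWFS.IsAlgHom p q (liftMapPost i s)) :
    AWFS.IsAlgHom (h ▸ p : EM.Alg (liftMap j g)) (h ▸ q : EM.Alg (liftMap j g'))
      (liftMapPost j s) := by
  subst h
  exact hs

end Lifting

/-! ### Gluing algebras along colimits of arrows -/

/-- The commutative square underlying a morphism of arrows. -/
def Square.ofArrowHom {C : Type w} [Category.{v} C] {f g : Arrow C} (s : f ⟶ g) :
    _root_.Square f.hom g.hom :=
  ⟨s.left, s.right, (Arrow.w s).symm⟩

/-- The commutative squares underlying the legs of a cocone of arrows. -/
def Square.ofCocone {C : Type w} [Category.{v} C] {J : Type u} [Category.{v} J] {F : J ⥤ Arrow C}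
    (c : Cocone F) (j : J) : _root_.Square (F.obj j).hom c.pt.hom :=
  Square.ofArrowHom (c.ι.app j)

/-- A cocone of arrows is colimiting if it is so on domains and on codomains. -/
def CategoryTheory.Arrow.isColimitOfLeftRight {C : Type w} [Category.{v} C] {J : Type u}
    [Category.{v} J] {F : J ⥤ Arrow C} {c : Cocone F}
    (hl : IsColimit (Arrow.leftFunc.mapCocone c)) (hr : IsColimit (Arrow.rightFunc.mapCocone c)) :
    IsColimit c where
  desc s := Arrow.homMk (hl.desc (Arrow.leftFunc.mapCocone s))
    (hr.desc (Arrow.rightFunc.mapCocone s)) (by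
      refine hl.hom_ext fun j => ?_
      have h1 := hl.fac (Arrow.leftFunc.mapCocone s) j
      have h2 := hr.fac (Arrow.rightFunc.mapCocone s) j
      have h3 := Arrow.w (c.ι.app j)
      have h4 := Arrow.w (s.ι.app j)
      change (c.ι.app j).left ≫ hl.desc (Arrow.leftFunc.mapCocone s) = (s.ι.app j).left at h1
      change (c.ι.app j).right ≫ hr.desc (Arrow.rightFunc.mapCocone s) = (s.ι.app j).right at h2
      change (c.ι.app j).left ≫ (_ : c.pt.left ⟶ s.pt.left) ≫ s.pt.hom =
        (c.ι.app j).left ≫ c.pt.hom ≫ (_ : c.pt.right ⟶ s.pt.right)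
      refine (Category.assoc _ _ _).symm.trans (Eq.trans (congrArg (· ≫ s.pt.hom) h1) ?_)
      refine h4.trans (Eq.trans ?_ (Category.assoc _ _ _))
      refine Eq.trans ?_ (congrArg (· ≫ hr.desc (Arrow.rightFunc.mapCocone s)) h3.symm)
      exact (congrArg ((F.obj j).hom ≫ ·) h2.symm).trans (Category.assoc _ _ _).symm)
  fac s j := by
    ext
    · exact hl.fac (Arrow.leftFunc.mapCocone s) j
    · exact hr.fac (Arrow.rightFunc.mapCocone s) j
  uniq s m hm := by
    ext
    · exact hl.uniq (Arrow.leftFunc.mapCocone s) m.left fun j => congrArg CommaMorphism.left (hm j)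
    · exact hr.uniq (Arrow.rightFunc.mapCocone s) m.right
        fun j => congrArg CommaMorphism.right (hm j)

/-! ### Preservation of pointwise colimits and gluing of algebras -/

namespace AWFS

/-- The functor `K` of the factorisation preserves colimits of arrows that are formed
pointwise. -/
def PreservesPointwiseColimits (EM : AWFS Preord.{u}) : Prop :=
  ∀ {J : Type u} [SmallCategory J] {F : J ⥤ Arrow Preord.{u}} (c : Cocone F),
    IsColimit (Arrow.leftFunc.mapCocone c) → IsColimit (Arrow.rightFunc.mapCocone c) →
      Nonempty (IsColimit (EM.functor.mapCocone c))

theorem IsCocontinuous.preservesPointwiseColimits {EM : AWFS Preord.{u}}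
    (h : EM.IsCocontinuous) : EM.PreservesPointwiseColimits := fun c hl hr => by
  have : PreservesColimitsOfSize.{u, u} EM.functor := h
  exact ⟨isColimitOfPreserves EM.functor (Arrow.isColimitOfLeftRight hl hr)⟩

/-- A map out of `K f` is a pair of maps `a`, `b` out of the domain and the codomain with `b ∘ f ≤
a`. The two maps are induced by the two colimits, and the inequality can be checked on the legs,
which are jointly surjective. -/
theorem raliAWFS_preservesPointwiseColimits : raliAWFS.{u}.PreservesPointwiseColimits := by
  intro J _ F c hl hr
  have hcw : ∀ (s : Cocone (F ⋙ raliAWFS.functor)), ∃ d : raliAWFS.K c.pt.hom ⟶ s.pt,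
      ∀ j, raliAWFS.functor.map (c.ι.app j) ≫ d = s.ι.app j := by
    intro s
    let sl : Cocone (F ⋙ Arrow.leftFunc) :=
      { pt := s.pt
        ι := { app := fun j => Preord.ofHom LaxColim.incA ≫ s.ι.app j
               naturality := fun j k m => Preord.ext fun x =>
                 ConcreteCategory.congr_hom (s.w m) (LaxColim.inA x) } }
    let sr : Cocone (F ⋙ Arrow.rightFunc) :=
      { pt := s.pt
        ι := { app := fun j => Preord.ofHom LaxColim.incB ≫ s.ι.app j
               naturality := fun j k m => Preord.ext fun x =>
                 ConcreteCategory.congr_hom (s.w m) (LaxColim.inB x) } }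
    have ha : ∀ j x, hl.desc sl ((c.ι.app j).left x) = s.ι.app j (LaxColim.inA x) :=
      fun j x => ConcreteCategory.congr_hom (hl.fac sl j) x
    have hb : ∀ j x, hr.desc sr ((c.ι.app j).right x) = s.ι.app j (LaxColim.inB x) :=
      fun j x => ConcreteCategory.congr_hom (hr.fac sr j) x
    have hle : ∀ x, hr.desc sr (c.pt.hom x) ≤ hl.desc sl x := by
      intro x
      obtain ⟨j, (y : (F.obj j).left), hy⟩ := Preord.exists_of_isColimit hl x
      obtain rfl : (c.ι.app j).left y = x := hy
      have hw : c.pt.hom ((c.ι.app j).left y) = (c.ι.app j).right ((F.obj j).hom y) :=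
        ConcreteCategory.congr_hom (Arrow.w (c.ι.app j)) y
      rw [hw, ha, hb]
      exact (s.ι.app j).hom.monotone (le_refl (α := (F.obj j).right) ((F.obj j).hom y))
    refine ⟨Preord.ofHom (LaxColim.desc (hl.desc sl).hom (hr.desc sr).hom hle), fun j =>
      Preord.ext fun x => ?_⟩
    cases x with
    | inA x => exact ha j x
    | inB x => exact hb j x
  choose d hd using hcw
  refine ⟨⟨d, hd, fun s m hm => ?_⟩⟩
  refine Preord.ext fun x => ?_
  cases x with
  | inA x =>
    obtain ⟨j, y, hy⟩ := Preord.exists_of_isColimit hl x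
    obtain rfl : (c.ι.app j).left y = x := hy
    exact ConcreteCategory.congr_hom ((hm j).trans (hd s j).symm) (LaxColim.inA y)
  | inB x =>
    obtain ⟨j, y, hy⟩ := Preord.exists_of_isColimit hr x
    obtain rfl : (c.ι.app j).right y = x := hy
    exact ConcreteCategory.congr_hom ((hm j).trans (hd s j).symm) (LaxColim.inB y)

/-- The endofunctor `f ↦ rho f` of the category of arrows. -/
def rightFunctor {C : Type w} [Category.{v} C] [PordCategory C] (W : AWFS C) :
    Arrow C ⥤ Arrow C where
  obj f := Arrow.mk (W.rho f.hom)
  map s := Arrow.homMk (W.functor.map s) s.right (W.rho_map (_root_.Square.ofArrowHom s)).symm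
  map_id f := by
    ext
    · exact W.functor.map_id f
    · rfl
  map_comp s t := by
    ext
    · exact W.functor.map_comp s t
    · rfl

section Glue

variable {EM : AWFS Preord.{u}} {J : Type u} [SmallCategory J] {F : J ⥤ Arrow Preord.{u}}
  {c : Cocone F}

theorem PreservesPointwiseColimits.hom_ext (h : EM.PreservesPointwiseColimits)
    (hl : IsColimit (Arrow.leftFunc.mapCocone c)) (hr : IsColimit (Arrow.rightFunc.mapCocone c))
    {Z : Preord.{u}} (a b : EM.K c.pt.hom ⟶ Z)
    (hab : ∀ j, EM.map (_root_.Square.ofCocone c j) ≫ a =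
      EM.map (_root_.Square.ofCocone c j) ≫ b) : a = b :=
  (h c hl hr).some.hom_ext hab

/-- Algebra structures on a diagram of arrows, compatible with its transition maps, induce an
algebra structure on its pointwise colimit. -/
theorem PreservesPointwiseColimits.exists_alg (h : EM.PreservesPointwiseColimits)
    (hl : IsColimit (Arrow.leftFunc.mapCocone c)) (hr : IsColimit (Arrow.rightFunc.mapCocone c))
    (p : ∀ j, EM.Alg (F.obj j).hom)
    (hp : ∀ {j k : J} (m : j ⟶ k), IsAlgHom (p j) (p k) (_root_.Square.ofArrowHom (F.map m))) :
    ∃ q : EM.Alg c.pt.hom, ∀ j, IsAlgHom (p j) q (_root_.Square.ofCocone c j) := by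
  obtain ⟨hK⟩ := h c hl hr
  -- By `hK` the arrows `rho` again form a pointwise colimit, so `K` preserves it once more. The
  -- associativity law, an equation out of `K (rho f)`, is tested on this second colimit.
  obtain ⟨hKK⟩ := h (EM.rightFunctor.mapCocone c) hK hr
  let s : Cocone (F ⋙ EM.functor) :=
    { pt := c.pt.left
      ι :=
        { app := fun j => (p j).str ≫ (c.ι.app j).left
          naturality := fun j k m => by
            have h1 := hp m
            have h2 := (Arrow.leftFunc.mapCocone c).w m
            unfold IsAlgHom at h1
            change EM.map (_root_.Square.ofArrowHom (F.map m)) ≫ (p k).str ≫ (c.ι.app k).left =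
              ((p j).str ≫ (c.ι.app j).left) ≫ 𝟙 _
            rw [← Category.assoc, ← h1, Category.comp_id, Category.assoc]
            exact congrArg _ h2 } }
  let q : EM.K c.pt.hom ⟶ c.pt.left := hK.desc s
  have hq : ∀ j, EM.map (_root_.Square.ofCocone c j) ≫ q =
      (p j).str ≫ (_root_.Square.ofCocone c j).left := hK.fac s
  have comm : EM.rho c.pt.hom ≫ 𝟙 _ = q ≫ c.pt.hom := by
    refine h.hom_ext hl hr _ _ fun j => ?_
    rw [← Category.assoc (EM.map _) q, hq, Category.comp_id, ← EM.rho_map, Category.assoc,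
      ← (_root_.Square.ofCocone c j).comm, ← Category.assoc, ← (p j).comm, Category.comp_id]
  refine ⟨⟨q, comm, ?_, ?_⟩, fun j => (hq j).symm⟩
  · refine hl.hom_ext fun j => ?_
    change (_root_.Square.ofCocone c j).left ≫ EM.lam c.pt.hom ≫ q =
      (_root_.Square.ofCocone c j).left ≫ 𝟙 c.pt.left
    rw [← Category.assoc, ← EM.lam_map, Category.assoc, hq, ← Category.assoc, (p j).unit,
      Category.id_comp, Category.comp_id]
  · refine hKK.hom_ext fun j => ?_
    change EM.map (EM.mapR (_root_.Square.ofCocone c j)) ≫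
        EM.map (f := EM.rho c.pt.hom) (g := c.pt.hom) ⟨q, 𝟙 c.pt.right, comm⟩ ≫ q =
      EM.map (EM.mapR (_root_.Square.ofCocone c j)) ≫ EM.pi c.pt.hom ≫ q
    rw [← Category.assoc _ (EM.pi _), EM.pi_nat, Category.assoc, hq,
      ← Category.assoc (EM.pi _), ← (p j).assoc, Category.assoc, ← hq, map_map_assoc,
      map_map_assoc]
    congr 2
    ext1
    · exact hq j
    · exact (Category.comp_id _).trans (Category.id_comp _).symm

end Glue

end AWFS

/-! ### Lifting structures on the chain of complete lattices -/

/-- The functor sending `X` to the comparison morphism of `i` and `X ⟶ 1`. -/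
def liftArrow {S T : Preord.{u}} (i : S ⟶ T) : Preord.{u} ⥤ Arrow Preord.{u} where
  obj X := Arrow.mk (liftMap i X.toOne)
  map h := Arrow.homMk (liftMapPost i (Preord.toOneSquare h)).left
    (liftMapPost i (Preord.toOneSquare h)).right (liftMapPost i (Preord.toOneSquare h)).comm.symm
  map_id _ := rfl
  map_comp _ _ := rfl

section Chain

variable (β : Cardinal.{u}) [Fact β.IsRegular]

/-- A map from a small preorder to a regular cardinal factors through a proper initial segment. -/
theorem Preord.exists_succChain_factor {S : Preord.{u}} (hS : Cardinal.mk S < β)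
    (f : S ⟶ Preord.of β.ord.ToType) :
    ∃ (μ : β.ord.ToType) (g : S ⟶ (Preord.succChain β.ord.ToType).obj μ),
      g ≫ (Preord.succCocone β.ord.ToType).ι.app μ = f := by
  obtain ⟨μ, hμ⟩ := Cardinal.exists_forall_le_of_mk_lt β hS f
  exact ⟨μ, Preord.ofHom ⟨fun s => ⟨f s, hμ s⟩, fun _ _ h => f.hom.monotone h⟩, rfl⟩

theorem Preord.succCocone_comp_injective {α : Type u} [Preorder α] {S : Preord.{u}} {μ : α}
    {g g' : S ⟶ (Preord.succChain α).obj μ}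
    (h : g ≫ (Preord.succCocone α).ι.app μ = g' ≫ (Preord.succCocone α).ι.app μ) : g = g' :=
  Preord.ext fun s => Subtype.ext (ConcreteCategory.congr_hom h s)

variable {S T : Preord.{u}} (i : S ⟶ T)

/-- Maps out of a preorder with fewer than `β` elements commute with the union of the chain: they
are bounded in `β`, and the inclusions are order embeddings. -/
theorem nonempty_isColimit_liftArrow_left (hT : Cardinal.mk T < β) :
    Nonempty (IsColimit (Arrow.leftFunc.mapCocone
      ((liftArrow i).mapCocone (Preord.succCocone β.ord.ToType)))) := by
  refine Preord.nonempty_isColimit_of_union _ ?_ ?_ ?_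
  · intro μ g g' h
    exact Preord.succCocone_comp_injective h
  · intro μ g g' h
    exact h
  · intro f
    exact Preord.exists_succChain_factor β hT f

theorem nonempty_isColimit_liftArrow_right (hS : Cardinal.mk S < β) :
    Nonempty (IsColimit (Arrow.rightFunc.mapCocone
      ((liftArrow i).mapCocone (Preord.succCocone β.ord.ToType)))) := by
  refine Preord.nonempty_isColimit_of_union _ ?_ ?_ ?_
  · intro μ g g' h
    exact Square.ext (Preord.succCocone_comp_injective (congrArg Square.left h))
      (Preord.ext fun _ => rfl)
  · intro μ g g' h
    exact ⟨h.1, fun _ => le_rfl⟩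
  · intro f
    obtain ⟨μ, g, hg⟩ := Preord.exists_succChain_factor β hS f.left
    exact ⟨μ, ⟨g, Preord.ofHom ⟨fun _ => PUnit.unit, fun _ _ _ => le_rfl⟩, rfl⟩,
      Square.ext hg rfl⟩

end Chain

/-! ### The non-generation theorems -/

theorem AWFS.PreservesPointwiseColimits.not_isCofibrantlyGenerated {EM : AWFS Preord.{u}}
    (hEM : EM.PreservesPointwiseColimits) : ¬ fullAWFS.{u}.IsCofibrantlyGenerated EM := by
  rintro ⟨J, U, e, he, -⟩
  -- The disjoint union of all objects in the image of `U` bounds each of them at once.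
  obtain ⟨β, hβ, hlt⟩ := Cardinal.exists_isRegular_mk_lt (Σ a : J.Obj, U.obj.obj a)
  have : Fact β.IsRegular := ⟨hβ⟩
  have hsize : ∀ a, Cardinal.mk (U.obj.obj a) < β := fun a =>
    lt_of_le_of_lt (Cardinal.mk_le_of_injective (f := fun x => (⟨a, x⟩ : Σ a, U.obj.obj a))
      fun x y h => by simpa using h) hlt
  let α := β.ord.ToType
  let p : ∀ μ : α, fullAWFS.Alg ((Preord.succChain α).obj μ).toOne :=
    fun μ => (Preord.succChain_isCompleteLattice μ).alg
  let l : ∀ μ : α, LiftStr EM U ((Preord.succChain α).obj μ).toOne := fun μ => e _ (p μ)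
  -- The inclusions preserve suprema, so they are morphisms of algebras, hence of lifting
  -- structures; this is the compatibility needed for gluing.
  have hl : ∀ {μ ν : α} (m : μ ⟶ ν) {a b : J.Obj} (i : J.Vert a b),
      IsAlgHom ((l μ).alg i) ((l ν).alg i)
        (liftMapPost (U.vert i) (Preord.toOneSquare ((Preord.succChain α).map m))) :=
    fun m _ _ i => (he _ _ _).1 ((isAlgHom_toOneSquare_iff _ _ _).2
      (Preord.succChain_map_isLUB m)) i
  let ι : ∀ μ : α, (Preord.succChain α).obj μ ⟶ Preord.of α := (Preord.succCocone α).ι.app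
  have epi : ∀ {a b : J.Obj} (i : J.Vert a b) {Z : Preord.{u}}
      (x y : EM.K (liftMap (U.vert i) (Preord.of α).toOne) ⟶ Z),
      (∀ μ, EM.map (liftMapPost (U.vert i) (Preord.toOneSquare (ι μ))) ≫ x =
        EM.map (liftMapPost (U.vert i) (Preord.toOneSquare (ι μ))) ≫ y) → x = y :=
    fun {a b} i _ x y h => hEM.hom_ext (nonempty_isColimit_liftArrow_left β _ (hsize b)).some
      (nonempty_isColimit_liftArrow_right β _ (hsize a)).some x y h
  have hex : ∀ {a b : J.Obj} (i : J.Vert a b),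
      ∃ q : EM.Alg (liftMap (U.vert i) (Preord.of α).toOne), ∀ μ, IsAlgHom ((l μ).alg i) q
        (liftMapPost (U.vert i) (Preord.toOneSquare (ι μ))) :=
    fun {a b} i => hEM.exists_alg
      (c := (liftArrow (U.vert i)).mapCocone (Preord.succCocone β.ord.ToType))
      (nonempty_isColimit_liftArrow_left β _ (hsize b)).some
      (nonempty_isColimit_liftArrow_right β _ (hsize a)).some (fun μ => (l μ).alg i)
      fun m => hl m i
  choose q hq using @hex
  have L : LiftStr EM U (Preord.of α).toOne :=
    { alg := q
      natural := fun {a b a' b' i j h k} σ => by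
        -- Precomposed with the leg at `μ`, the claim is naturality on `succ μ` followed by the leg
        -- for `i`.
        refine IsAlgHom.of_jointly_epi (epi j) (hq j) fun μ => ?_
        exact ((l μ).natural σ).comp (hq i μ)
      comp := fun {a b c} i j => by
        have h1 := fun μ => AWFS.isAlgHom_liftMapPost_cast (U.vert_comp i j) (hq (J.vComp i j) μ)
        have h2 := fun μ => AWFS.Alg.compLeft_isAlgHom (hq i μ) (hq j μ)
        have epi' := @epi _ _ (J.vComp i j)
        rw [U.vert_comp] at epi'
        -- Both structures on the composite make every leg a morphism, from sources that agree by
        -- the composition axiom at stage `μ`.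
        refine IsAlgHom.eq_of_id (IsAlgHom.of_jointly_epi epi' h1 fun μ => ?_)
        rw [(l μ).comp]
        exact h2 μ }
  exact Preord.not_isCompleteLattice_ord β (.of_rightClass ((e _).symm L).rightClass)

/-- A lifting problem against `β ⟶ 1` only involves a map from the domain of a generator. For `β`
larger than all these domains the map factors through some `succ μ`, which is in the right class;
the lift found there is composed with the inclusion, and the triangle over `1` is automatic. -/
theorem fullAWFS_not_isWFSCofibrantlyGenerated : ¬ fullAWFS.{u}.IsWFSCofibrantlyGenerated := by
  rintro ⟨I, hI, h⟩
  have : Small.{u} I.toSet := hI.small_toSet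
  obtain ⟨β, hβ, hlt⟩ := Cardinal.exists_isRegular_mk_lt
    (Σ a : Shrink.{u} I.toSet, ((equivShrink I.toSet).symm a).1.left)
  have : Fact β.IsRegular := ⟨hβ⟩
  refine Preord.not_isCompleteLattice_ord β ((rightClass_toOne_iff _).1 ?_)
  rw [h]
  intro S T i hi
  have hS : Cardinal.mk S < β := by
    refine lt_of_le_of_lt ?_ hlt
    obtain ⟨a, ha⟩ := (equivShrink I.toSet).symm.surjective ⟨Arrow.mk i, hi⟩
    have hS' : S = ((equivShrink I.toSet).symm a).1.left := by rw [ha]; rfl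
    rw [hS']
    exact Cardinal.mk_le_of_injective
      (f := fun x => (⟨a, x⟩ : Σ a : Shrink.{u} I.toSet, ((equivShrink I.toSet).symm a).1.left))
      fun x y h => by simpa using h
  refine ⟨fun {f g} sq => ?_⟩
  obtain ⟨μ, f', hf'⟩ := Preord.exists_succChain_factor β hS f
  have hμ : I.rlp ((Preord.succChain β.ord.ToType).obj μ).toOne := by
    rw [← h]
    exact (rightClass_toOne_iff _).2 (Preord.succChain_isCompleteLattice μ)
  have hl := hμ i hi
  have sq' : CommSq f' i ((Preord.succChain β.ord.ToType).obj μ).toOne g := ⟨rfl⟩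
  refine ⟨⟨⟨sq'.lift ≫ (Preord.succCocone β.ord.ToType).ι.app μ, ?_, rfl⟩⟩⟩
  exact (Category.assoc _ _ _).symm.trans
    ((congrArg (· ≫ (Preord.succCocone β.ord.ToType).ι.app μ) sq'.fac_left).trans hf')

theorem mainTheorem4 :
    -- the AWFS is lax orthogonal
    fullAWFS.{u}.IsLaxOrthogonal ∧
    -- its left maps are the full maps
    (∀ {A B : Preord.{u}} (f : A ⟶ B), Nonempty (fullAWFS.Coalg f) ↔ Preord.IsFull f) ∧
    (∀ {A B : Preord.{u}} (f : A ⟶ B), fullAWFS.leftClass f ↔ Preord.IsFull f) ∧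
    -- its fibrant objects are the complete lattices, with the sup-preserving maps as morphisms
    (∀ X : Preord.{u}, Nonempty (fullAWFS.Alg X.toOne) ↔ X.IsCompleteLattice) ∧
    (∀ X : Preord.{u}, fullAWFS.rightClass X.toOne ↔ X.IsCompleteLattice) ∧
    (∀ {X Y : Preord.{u}} (p : fullAWFS.Alg X.toOne) (q : fullAWFS.Alg Y.toOne) (h : X ⟶ Y),
      AWFS.IsAlgHom p q (Preord.toOneSquare h) ↔
        ∀ (s : Set X) (x : X), IsLUB s x → IsLUB (h '' s) (h x)) ∧
    -- it is not cofibrantly KZ-generated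
    ¬ fullAWFS.{u}.IsCofibrantlyKZGenerated ∧
    -- it is not cofibrantly generated with respect to any cocontinuous AWFS on preorders
    (∀ EM : AWFS Preord.{u}, EM.IsCocontinuous → ¬ fullAWFS.{u}.IsCofibrantlyGenerated EM) ∧
    -- its underlying WFS is not cofibrantly generated
    ¬ fullAWFS.{u}.IsWFSCofibrantlyGenerated ∧
    -- every regular cardinal `β` is a `β`-filtered union of the complete lattices `succ μ` and
    -- their sup-preserving inclusions, but it is not itself a complete lattice
    (∀ (β : Cardinal.{u}) [Fact β.IsRegular],
      IsCardinalFiltered β.ord.ToType β ∧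
      (∀ μ : β.ord.ToType, ((Preord.succChain β.ord.ToType).obj μ).IsCompleteLattice) ∧
      (∀ {μ ν : β.ord.ToType} (h : μ ⟶ ν) (s : Set ((Preord.succChain β.ord.ToType).obj μ))
        (x : (Preord.succChain β.ord.ToType).obj μ), IsLUB s x →
          IsLUB ((Preord.succChain β.ord.ToType).map h '' s)
            ((Preord.succChain β.ord.ToType).map h x)) ∧
      Nonempty (IsColimit (Preord.succCocone β.ord.ToType)) ∧
      ¬ (Preord.of β.ord.ToType).IsCompleteLattice) := by 
  refine ⟨fullAWFS_isLaxOrthogonal, nonempty_coalg_iff_isFull, leftClass_iff_isFull,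
    nonempty_alg_toOne_iff, rightClass_toOne_iff, isAlgHom_toOneSquare_iff,
    AWFS.PreservesPointwiseColimits.not_isCofibrantlyGenerated
      AWFS.raliAWFS_preservesPointwiseColimits,
    fun _ hEM => AWFS.PreservesPointwiseColimits.not_isCofibrantlyGenerated
      hEM.preservesPointwiseColimits,
    fullAWFS_not_isWFSCofibrantlyGenerated, fun β _ => ⟨inferInstance,
      Preord.succChain_isCompleteLattice, Preord.succChain_map_isLUB,
      Preord.nonempty_isColimit_succCocone _, Preord.not_isCompleteLattice_ord β⟩⟩
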